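/- Let $\mathcal A$ be a finite set of lines in the real projective plane $\mathbb P^2(\mathbb R)$. Let $Sing(\mathcal A)$ be the set of points lying on at least two lines of $\mathcal A$; for $P\in Sing(\mathcal A)$ let $m(P,\mathcal A)$ be the number of lines of $\mathcal A$ through $P$; let $m(\mathcal A)=\max\{m(P,\mathcal A): P\in Sing(\mathcal A)\}$, and let $Sing_2(\mathcal A)=\{P\in Sing(\mathcal A): m(P,\mathcal A)=2\}$ be the set of simple points. Call $\mathcal A$ supersolvable if there is a point $P\in Sing(\mathcal A)$ such that for every other $Q\in Sing(\mathcal A)$ the line through $P$ and $Q$ belongs to $\mathcal A$. For $m\ge 3$ let $\mathcal A_{2m}$ be the Böröczky arrangement, consisting of the $2m$ lines $$\cos\tfrac{2\pi j}{m}\,x+\sin\tfrac{2\pi j}{m}\,y+z=0,\qquad -\sin\tfrac{\pi j}{m}\,x+\cos\tfrac{\pi j}{m}\,y=0\qquad(0\le j<m).$$ Let $K$ be an integral domain of characteristic $0$ (for example $\mathbb Z$, $\mathbb Q$, $\mathbb R$ or $\mathbb C$). The Orlik–Solomon algebra $OS(\mathcal A)$ over $K$ is the quotient of the exterior algebra over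 $K$ on generators $e_H$, $H\in\mathcal A$, by the two-sided ideal generated by the elements $\sum_{i=0}^{p}(-1)^{i}e_{H_0}\cdots\widehat{e_{H_i}}\cdots e_{H_p}$, for all tuples $(H_0,\dots,H_p)$ of lines of $\mathcal A$ whose defining linear forms are linearly dependent; it is graded by $\deg e_H=1$. **Theorem 2.6.** Let $\mathcal A$ be a supersolvable real line arrangement with $m:=m(\mathcal A)\ge 3$ and $|\mathcal A|=2m$. Then $|Sing_2(\mathcal A)|=m$ if and only if $\mathcal A$ and $\mathcal A_{2m}$ are combinatorially equivalent, meaning that $OS(\mathcal A)$ and $OS(\mathcal A_{2m})$ are isomorphic. This holds both with "isomorphic" read as isomorphic $K$-algebras and with "isomorphic" read as isomorphic graded $K$-algebras. -/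

import Mathlib

noncomputable section

namespace LineArr

/-- A line arrangement in the real projective plane: a finite set of lines, a line being given
by the class of the coefficient vector of its equation. Points of the plane have the same type;
the point `P` lies on the line `l` when `Projectivization.orthogonal P l`, that is, when the
coordinates of `P` satisfy the equation `l`. -/
abbrev Arrangement : Type := Finset (Projectivization ℝ (Fin 3 → ℝ))

/-- The singularities: the points where two different lines of the arrangement meet. -/
def Sing (A : Arrangement) : Set (Projectivization ℝ (Fin 3 → ℝ)) :=
  {P | ∃ l ∈ A, ∃ l' ∈ A, l ≠ l' ∧
    Projectivization.orthogonal P l ∧ Projectivization.orthogonal P l'}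

/-- The multiplicity `m(P, A)`: the number of lines of `A` through `P`. -/
def mult (A : Arrangement) (P : Projectivization ℝ (Fin 3 → ℝ)) : ℕ :=
  {l | l ∈ A ∧ Projectivization.orthogonal P l}.ncard

theorem mult_le_card (A : Arrangement) (P : Projectivization ℝ (Fin 3 → ℝ)) :
    mult A P ≤ A.card := by
  rw [← Set.ncard_coe_finset]
  exact Set.ncard_le_ncard (fun l hl => hl.1) A.finite_toSet

/-- The multiplicity `m(A)`: the maximum of `m(P, A)` over the singularities `P` of `A`. -/
def maxMult (A : Arrangement) : ℕ := sSup (mult A '' Sing A)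

theorem isGreatest_maxMult (A : Arrangement) (h : (Sing A).Nonempty) :
    IsGreatest (mult A '' Sing A) (maxMult A) := by
  have hb : BddAbove (mult A '' Sing A) := by
    refine ⟨A.card, ?_⟩
    rintro _ ⟨P, -, rfl⟩
    exact mult_le_card A P
  exact ⟨Nat.sSup_mem (h.image _) hb, fun k hk => le_csSup hb hk⟩

/-- The simple points: the singularities of multiplicity `2`. -/
def Sing₂ (A : Arrangement) : Set (Projectivization ℝ (Fin 3 → ℝ)) :=
  {P | P ∈ Sing A ∧ mult A P = 2}

/-- `A` is supersolvable: some singularity `P` is modular, that is, for any other singularity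
`Q` the line through `P` and `Q` belongs to `A`. -/
def Supersolvable (A : Arrangement) : Prop :=
  ∃ P ∈ Sing A, ∀ Q ∈ Sing A, Q ≠ P →
    ∃ l ∈ A, Projectivization.orthogonal P l ∧ Projectivization.orthogonal Q l

theorem vec₁_ne_zero (t : ℝ) : ![Real.cos t, Real.sin t, 1] ≠ 0 := by
  intro h
  simpa using congrFun h 2

theorem vec₂_ne_zero (t : ℝ) : ![-Real.sin t, Real.cos t, 0] ≠ 0 := by
  intro h
  have h0 : Real.sin t = 0 := by simpa using congrFun h 0
  have h1 : Real.cos t = 0 := by simpa using congrFun h 1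
  simpa [h0, h1] using Real.sin_sq_add_cos_sq t

open Classical in
/-- The Böröczky arrangement of `2 m` lines: the lines
`cos (2πj/m) x + sin (2πj/m) y + z = 0` and `-sin (πj/m) x + cos (πj/m) y = 0`, `0 ≤ j < m`. -/
def boroczky (m : ℕ) : Arrangement :=
  (Finset.range m).image (fun j : ℕ =>
      Projectivization.mk ℝ ![Real.cos (2 * Real.pi * j / m), Real.sin (2 * Real.pi * j / m), 1]
        (vec₁_ne_zero _)) ∪
    (Finset.range m).image (fun j : ℕ =>
      Projectivization.mk ℝ ![-Real.sin (Real.pi * j / m), Real.cos (Real.pi * j / m), 0]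
        (vec₂_ne_zero _))

section OrlikSolomon

universe u

variable (K : Type u) [CommRing K] (A : Arrangement)

/-- The exterior algebra over `K` with one generator `e_H` for each line `H` of `A`. -/
abbrev Ext : Type u := ExteriorAlgebra K (A →₀ K)

/-- `∂ e_S = ∑ᵢ (-1)ⁱ e_{H₀} ⋯ (omit e_{Hᵢ}) ⋯ e_{Hₚ}` for a tuple `S = (H₀, …, Hₚ)` of lines
of `A`. -/
def boundary {p : ℕ} (S : Fin (p + 1) → A) : Ext K A :=
  ∑ i : Fin (p + 1), (-1 : K) ^ (i : ℕ) •
    ExteriorAlgebra.ιMulti K p (fun j => Finsupp.single (S (i.succAbove j)) (1 : K))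

/-- The Orlik–Solomon relations: `∂ e_S = 0` for every tuple `S` of lines of `A` whose
equations are linearly dependent. -/
inductive OSRel : Ext K A → Ext K A → Prop
  | of {p : ℕ} (S : Fin (p + 1) → A)
      (hS : Projectivization.Dependent (fun i => (S i : Projectivization ℝ (Fin 3 → ℝ)))) :
      OSRel (boundary K A S) 0

/-- The Orlik–Solomon algebra of `A` with coefficients in `K`: the quotient of the exterior
algebra by the two-sided ideal generated by the Orlik–Solomon relations. -/
abbrev OS : Type u := RingQuot (OSRel K A)

/-- The homogeneous part of degree `k` of the Orlik–Solomon algebra. -/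
def OSDeg (k : ℕ) : Submodule K (OS K A) :=
  (⋀[K]^k (A →₀ K)).map (RingQuot.mkAlgHom K (OSRel K A)).toLinearMap

end OrlikSolomon

end LineArr

end

/-! A point at least as multiple as a modular point is itself modular (`Modular.of_mult_le`), so
some modular point `P` has multiplicity `m`. Dually, the `m` lines through `P` become `m` slopes `t
0 < ... < t (m - 1)`, the other `m` lines become `m` points of an affine plane, and modularity says
that any two of these points are joined by a line of one of these slopes. Simple points of the
arrangement are pairs of a slope and a point alone on its line of that slope (`ncard_sing₂`).

Let `c s` be the number of lines of slope `t s` through the points. Heights in cyclically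
consecutive directions never order two points oppositely, which forces `c s + c (s + 1) ≥ m + 1`. On
the other hand `2 * c s` is at most `m` plus the number of points alone in direction `s`. Summing
gives at least `m` simple points. Equality means that no line contains three of the points and that
consecutive directions are tight (`SlopesIn.extremal`). Exchanging the two points on each line of
slope `t s` gives an involution `r s`; tightness yields `r (s + 2) ∘ r (s + 1) = r (s + 1) ∘ r s`
(`braid`), so the involutions are the reflections of a dihedral action, transitive on the points. As
for a regular polygon, points and directions are then labelled by `ℤ/m` so that points `i` and `j`
lie in direction `i + j` (`SlopesIn.exists_labels`). The Böröczky arrangement carries the same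
labelling, so the dependent tuples agree, and so do the graded Orlik–Solomon algebras.

Conversely, any algebra isomorphism, graded or not, has an injective linear part in degree one. If
there are not exactly `m` simple points, three of the dual points lie on a line of an available
slope, which gives a second point of multiplicity at least four. For a pencil of at least four
lines, the differences of its generators multiply to zero in pairs and span dimension at least
three. The resonance conditions at the double and triple points of a labelled arrangement force the
image of such a space to be supported on the `m` lines of the pencil `y`
(`linearize_apply_x_eq_zero`). The two large pencils together give `m + 1` independent vectors,
which do not fit there (`not_os_equiv_labelling`). -/

namespace LineArr

/-! ### Homomorphisms out of the Orlik–Solomon algebra -/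

section OrlikSolomonMaps

universe u

variable {K : Type u} [CommRing K] {A B : Arrangement}

/-- The class of a degree one element in the Orlik–Solomon algebra. -/
noncomputable def osι (K : Type u) [CommRing K] (A : Arrangement) : (A →₀ K) →ₗ[K] OS K A :=
  (RingQuot.mkAlgHom K (OSRel K A)).toLinearMap ∘ₗ ExteriorAlgebra.ι K

theorem osι_mul_self (a : A →₀ K) : osι K A a * osι K A a = 0 := by
  simp only [osι, LinearMap.comp_apply, AlgHom.toLinearMap_apply, ← map_mul,
    ExteriorAlgebra.ι_sq_zero, map_zero]

theorem os_algHom_ext {T : Type*} [Ring T] [Algebra K T] {f g : OS K A →ₐ[K] T}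
    (h : ∀ a, f (osι K A a) = g (osι K A a)) : f = g := by
  apply RingQuot.ringQuot_ext'
  apply ExteriorAlgebra.hom_ext
  ext1 a
  ext
  exact h _

theorem os_induction {C : OS K A → Prop} (h0 : ∀ r : K, C (algebraMap K _ r))
    (h1 : ∀ a, C (osι K A a)) (hmul : ∀ x y, C x → C y → C (x * y))
    (hadd : ∀ x y, C x → C y → C (x + y)) (x : OS K A) : C x := by
  obtain ⟨w, rfl⟩ := RingQuot.mkAlgHom_surjective K (OSRel K A) x
  induction w using ExteriorAlgebra.induction with
  | algebraMap r => simpa using h0 r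
  | ι a => exact h1 a
  | mul a b ha hb => simpa using hmul _ _ ha hb
  | add a b ha hb => simpa using hadd _ _ ha hb

theorem lift_boundary {T : Type*} [Ring T] [Algebra K T] (f : (A →₀ K) →ₗ[K] T)
    (hf : ∀ a, f a * f a = 0) {p : ℕ} (S : Fin (p + 1) → A) :
    ExteriorAlgebra.lift K ⟨f, hf⟩ (boundary K A S) = ∑ i : Fin (p + 1), (-1 : K) ^ (i : ℕ) •
      (List.ofFn fun j => f (Finsupp.single (S (i.succAbove j)) 1)).prod := by
  simp only [boundary, map_sum, map_smul, ExteriorAlgebra.ιMulti_apply, map_list_prod,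
    List.map_ofFn]
  simp only [Function.comp_def, ExteriorAlgebra.lift_ι_apply]

theorem not_dependent_one (S : Fin 1 → Projectivization ℝ (Fin 3 → ℝ)) :
    ¬ Projectivization.Dependent S := by
  rw [Projectivization.dependent_iff, not_not]
  exact LinearIndependent.of_subsingleton 0 (Projectivization.rep_nonzero _)

theorem dependent_two (S : Fin 2 → Projectivization ℝ (Fin 3 → ℝ)) :
    Projectivization.Dependent S ↔ S 0 = S 1 := by
  rw [← Projectivization.dependent_pair_iff_eq]
  have : S = ![S 0, S 1] := by ext i; fin_cases i <;> rfl
  rw [← this]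

theorem fin_three_eta {α : Type*} (S : Fin 3 → α) : S = ![S 0, S 1, S 2] := by
  ext i; fin_cases i <;> rfl

/-- Squares being zero makes the values of `f` anticommute, and the product of differences then
expands to the three terms of the boundary. In this factored form, the relation at a multiple point
says that differences of its lines multiply to zero. -/
theorem lift_boundary_two {T : Type*} [Ring T] [Algebra K T] (f : (A →₀ K) →ₗ[K] T)
    (hf : ∀ a, f a * f a = 0) (S : Fin 3 → A) :
    ExteriorAlgebra.lift K ⟨f, hf⟩ (boundary K A S) =
      (f (Finsupp.single (S 1) 1) - f (Finsupp.single (S 0) 1)) *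
        (f (Finsupp.single (S 2) 1) - f (Finsupp.single (S 0) 1)) := by
  rw [lift_boundary, Fin.sum_univ_three]
  have e : f (Finsupp.single (S 0) 1) * f (Finsupp.single (S 1) 1) =
      - (f (Finsupp.single (S 1) 1) * f (Finsupp.single (S 0) 1)) := by
    have := hf (Finsupp.single (S 0) 1 + Finsupp.single (S 1) 1)
    rw [map_add, add_mul, mul_add, mul_add, hf, hf, zero_add, add_zero] at this
    exact eq_neg_of_add_eq_zero_left this
  have e1 : Fin.succAbove (1 : Fin 3) (0 : Fin 2) = 0 := rfl
  have e2 : Fin.succAbove (1 : Fin 3) (1 : Fin 2) = 2 := rfl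
  have e3 : Fin.succAbove (2 : Fin 3) (0 : Fin 2) = 0 := rfl
  have e4 : Fin.succAbove (2 : Fin 3) (1 : Fin 2) = 1 := rfl
  have e5 : Fin.succAbove (0 : Fin 3) (0 : Fin 2) = 1 := rfl
  have e6 : Fin.succAbove (0 : Fin 3) (1 : Fin 2) = 2 := rfl
  simp only [List.ofFn_succ, List.ofFn_zero, List.prod_cons, List.prod_nil, mul_one, e1, e2, e3, e4,
    e5, e6, Fin.succ_zero_eq_one, Fin.val_zero, Fin.val_one, Fin.val_two, pow_zero, one_smul,
    pow_one, neg_smul, even_two.neg_one_pow, sub_mul, mul_sub, hf]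
  rw [e]
  abel

/-- Algebra homomorphisms out of the Orlik–Solomon algebra into algebras in which triple products
of degree one elements vanish. -/
theorem exists_osLift {T : Type*} [Ring T] [Algebra K T] (f : (A →₀ K) →ₗ[K] T)
    (hf : ∀ a, f a * f a = 0)
    (h2 : ∀ S : Fin 3 → A,
      Projectivization.Dependent (fun i => (S i : Projectivization ℝ (Fin 3 → ℝ))) →
      (f (Finsupp.single (S 1) 1) - f (Finsupp.single (S 0) 1)) *
        (f (Finsupp.single (S 2) 1) - f (Finsupp.single (S 0) 1)) = 0)
    (h3 : ∀ a b c, f a * (f b * f c) = 0) :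
    ∃ g : OS K A →ₐ[K] T, ∀ a, g (osι K A a) = f a := by
  have hrel : ∀ ⦃x y⦄, OSRel K A x y →
      ExteriorAlgebra.lift K ⟨f, hf⟩ x = ExteriorAlgebra.lift K ⟨f, hf⟩ y := by
    rintro _ _ ⟨S, hS⟩
    rw [map_zero]
    rename_i p
    -- One line is never dependent, a dependent pair is a repeated line, triples are covered by
    -- `h2`, and in longer relations every term has at least three factors.
    match p, S, hS with
    | 0, S, hS => exact absurd hS (not_dependent_one _)
    | 1, S, hS =>
      have h01 : S 0 = S 1 := Subtype.ext ((dependent_two _).1 hS)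
      rw [lift_boundary, Fin.sum_univ_two]
      have e1 : Fin.succAbove (1 : Fin 2) (0 : Fin 1) = 0 := rfl
      simp [List.ofFn_succ, e1, h01]
    | 2, S, hS => rw [lift_boundary_two, h2 S hS]
    | p + 3, S, hS =>
      rw [lift_boundary]
      refine Finset.sum_eq_zero fun i _ => ?_
      simp only [List.ofFn_succ, List.prod_cons]
      rw [← mul_assoc (f _) (f _) (List.prod _), ← mul_assoc, h3, zero_mul, smul_zero]
  refine ⟨RingQuot.liftAlgHom K ⟨ExteriorAlgebra.lift K ⟨f, hf⟩, hrel⟩, fun a => ?_⟩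
  simp [osι]

theorem osι_sub_mul_sub (S : Fin 3 → A)
    (hS : Projectivization.Dependent (fun i => (S i : Projectivization ℝ (Fin 3 → ℝ)))) :
    osι K A (Finsupp.single (S 1) 1 - Finsupp.single (S 0) 1) *
      osι K A (Finsupp.single (S 2) 1 - Finsupp.single (S 0) 1) = 0 := by
  rw [map_sub, map_sub, ← lift_boundary_two (osι K A) osι_mul_self]
  have : ExteriorAlgebra.lift K ⟨osι K A, osι_mul_self⟩ = RingQuot.mkAlgHom K (OSRel K A) := by
    apply ExteriorAlgebra.hom_ext
    ext
    simp [osι]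
  rw [this, RingQuot.mkAlgHom_rel K (OSRel.of S hS), map_zero]

/-- The degree zero and degree one coordinates on the Orlik–Solomon algebra. -/
theorem exists_linearPart (K : Type u) [CommRing K] (A : Arrangement) :
    ∃ g : OS K A →ₐ[K] TrivSqZeroExt K (A →₀ K), ∀ a, g (osι K A a) = TrivSqZeroExt.inr a := by
  apply exists_osLift (TrivSqZeroExt.inrHom K (A →₀ K))
  · intro a; simp
  · intro S _
    simp only [TrivSqZeroExt.inrHom_apply, ← TrivSqZeroExt.inr_sub]
    exact TrivSqZeroExt.inr_mul_inr ..
  · intro a b c; simp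

noncomputable def linearPart (K : Type u) [CommRing K] (A : Arrangement) :
    OS K A →ₐ[K] TrivSqZeroExt K (A →₀ K) :=
  (exists_linearPart K A).choose

@[simp]
theorem linearPart_osι (a : A →₀ K) : linearPart K A (osι K A a) = TrivSqZeroExt.inr a :=
  (exists_linearPart K A).choose_spec a

/-- Left multiplication by `α e₁ + β e₂` on the exterior algebra with basis
`1, e₁, e₂, e₁ e₂`. -/
def extMat (α β : K) : Matrix (Fin 4) (Fin 4) K :=
  !![0, 0, 0, 0; α, 0, 0, 0; β, 0, 0, 0; 0, -β, α, 0]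

def extTop (γ : K) : Matrix (Fin 4) (Fin 4) K :=
  !![0, 0, 0, 0; 0, 0, 0, 0; 0, 0, 0, 0; γ, 0, 0, 0]

theorem extMat_mul (α β α' β' : K) :
    extMat α β * extMat α' β' = extTop (α * β' - β * α') := by
  ext i j
  fin_cases i <;> fin_cases j <;> simp [extMat, extTop, Matrix.mul_apply, Fin.sum_univ_four]
  ring

theorem extMat_mul_extTop (α β γ : K) : extMat α β * extTop γ = 0 := by
  ext i j
  fin_cases i <;> fin_cases j <;> simp [extMat, extTop, Matrix.mul_apply, Fin.sum_univ_four]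

theorem extTop_mul_extMat (α β γ : K) : extTop γ * extMat α β = 0 := by
  ext i j
  fin_cases i <;> fin_cases j <;> simp [extMat, extTop, Matrix.mul_apply, Fin.sum_univ_four]

theorem extTop_mul_extTop (γ δ : K) : extTop γ * extTop δ = 0 := by
  ext i j
  fin_cases i <;> fin_cases j <;> simp [extTop, Matrix.mul_apply, Fin.sum_univ_four]

theorem extMat_add (α β α' β' : K) :
    extMat α β + extMat α' β' = extMat (α + α') (β + β') := by
  ext i j
  fin_cases i <;> fin_cases j <;> simp [extMat]
  ring

theorem extTop_add (γ δ : K) : extTop γ + extTop δ = extTop (γ + δ) := by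
  ext i j
  fin_cases i <;> fin_cases j <;> simp [extTop]

theorem smul_extMat (c α β : K) : c • extMat α β = extMat (c * α) (c * β) := by
  ext i j
  fin_cases i <;> fin_cases j <;> simp [extMat]

theorem smul_extTop (c γ : K) : c • extTop γ = extTop (c * γ) := by
  ext i j
  fin_cases i <;> fin_cases j <;> simp [extTop]

@[simp] theorem extTop_zero : extTop (0 : K) = 0 := by
  ext i j
  fin_cases i <;> fin_cases j <;> simp [extTop]

/-- A pair of linear forms whose exterior product kills the quadratic Orlik–Solomon relations
also kills the products that vanish in the Orlik–Solomon algebra. -/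
theorem wedge_eq_zero_of_mul_eq_zero (α β : (A →₀ K) →ₗ[K] K)
    (h : ∀ S : Fin 3 → A,
      Projectivization.Dependent (fun i => (S i : Projectivization ℝ (Fin 3 → ℝ))) →
      (α (Finsupp.single (S 1) 1) - α (Finsupp.single (S 0) 1)) *
          (β (Finsupp.single (S 2) 1) - β (Finsupp.single (S 0) 1)) =
        (β (Finsupp.single (S 1) 1) - β (Finsupp.single (S 0) 1)) *
          (α (Finsupp.single (S 2) 1) - α (Finsupp.single (S 0) 1)))
    {x y : OS K A} (hx : (linearPart K A x).fst = 0) (hy : (linearPart K A y).fst = 0)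
    (hxy : x * y = 0) :
    α (linearPart K A x).snd * β (linearPart K A y).snd =
      β (linearPart K A x).snd * α (linearPart K A y).snd := by
  -- The pair `(α, β)` maps degree one to the exterior algebra on two generators, realised by left
  -- multiplications, where triple products vanish.
  let f : (A →₀ K) →ₗ[K] Matrix (Fin 4) (Fin 4) K :=
    { toFun := fun a => extMat (α a) (β a)
      map_add' := fun a b => by rw [extMat_add, map_add, map_add]
      map_smul' := fun c a => by simp [smul_extMat] }
  have hf : ∀ a, f a = extMat (α a) (β a) := fun a => rfl
  obtain ⟨g, hg⟩ := exists_osLift f (fun a => by rw [hf, extMat_mul, mul_comm, sub_self, extTop_zero])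
    (fun S hS => by
      rw [← map_sub, ← map_sub, hf, hf, extMat_mul, map_sub, map_sub, map_sub, map_sub, h S hS,
        sub_self, extTop_zero])
    (fun a b c => by rw [hf, hf, hf, extMat_mul, extMat_mul_extTop])
  have key : ∀ z : OS K A, ∃ t, g z = (linearPart K A z).fst • (1 : Matrix (Fin 4) (Fin 4) K) +
      f (linearPart K A z).snd + extTop t := by
    intro z
    induction z using os_induction with
    | h0 r =>
      refine ⟨0, ?_⟩
      simp [Algebra.algebraMap_eq_smul_one]
    | h1 a => exact ⟨0, by simp [hg]⟩
    | hmul x y hx hy =>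
      obtain ⟨s, hs⟩ := hx
      obtain ⟨t, ht⟩ := hy
      rw [map_mul, hs, ht, map_mul, TrivSqZeroExt.fst_mul, TrivSqZeroExt.snd_mul]
      simp only [hf, map_add, map_smul, add_mul, mul_add, extMat_mul, extMat_mul_extTop,
        extTop_mul_extMat, extTop_mul_extTop, smul_mul_assoc, mul_smul_comm, one_mul, mul_one,
        smul_extMat, smul_extTop, op_smul_eq_smul, smul_eq_mul, ← extMat_add]
      generalize (linearPart K A x).fst = p
      generalize (linearPart K A y).fst = q
      generalize (linearPart K A x).snd = a
      generalize (linearPart K A y).snd = b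
      refine ⟨q * s + (p * t + (α a * β b - β a * α b)), ?_⟩
      rw [← extTop_add, ← extTop_add]
      simp only [smul_add, smul_smul, smul_extMat, smul_extTop, mul_comm q]
      abel
    | hadd x y hx hy =>
      obtain ⟨s, hs⟩ := hx
      obtain ⟨t, ht⟩ := hy
      refine ⟨s + t, ?_⟩
      rw [map_add, hs, ht, map_add, TrivSqZeroExt.fst_add, TrivSqZeroExt.snd_add, map_add, add_smul,
        ← extTop_add]
      abel
  obtain ⟨s, hs⟩ := key x
  obtain ⟨t, ht⟩ := key y
  have := congrArg g hxy
  rw [map_mul, hs, ht, hx, hy, map_zero, zero_smul, zero_add, zero_add, hf, hf, add_mul, mul_add,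
    mul_add, extMat_mul, extMat_mul_extTop, extTop_mul_extMat, extTop_mul_extTop, add_zero,
    add_zero, add_zero] at this
  -- The corner entry is the coefficient of `e₁ e₂`, the determinant of the two linear parts under
  -- `(α, β)`.
  have h30 := congrFun (congrFun this 3) 0
  simpa [extTop, sub_eq_zero] using h30

end OrlikSolomonMaps

/-! ### From equal dependencies to isomorphic Orlik–Solomon algebras -/

section Matroid

universe u

variable {K : Type u} [CommRing K] {A B : Arrangement}

theorem boundary_map (e : A → B) {p : ℕ} (S : Fin (p + 1) → A) :
    ExteriorAlgebra.map (Finsupp.lmapDomain K K e) (boundary K A S) = boundary K B (e ∘ S) := by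
  simp only [boundary, map_sum, map_smul, ExteriorAlgebra.map_apply_ιMulti]
  simp [Function.comp_def]

theorem exists_osMap (e : A → B)
    (he : ∀ {p : ℕ} (S : Fin (p + 1) → A),
      Projectivization.Dependent (fun i => (S i : Projectivization ℝ (Fin 3 → ℝ))) →
      Projectivization.Dependent (fun i => (e (S i) : Projectivization ℝ (Fin 3 → ℝ)))) :
    ∃ g : OS K A →ₐ[K] OS K B, g.comp (RingQuot.mkAlgHom K (OSRel K A)) =
      (RingQuot.mkAlgHom K (OSRel K B)).comp
        (ExteriorAlgebra.map (Finsupp.lmapDomain K K e)) := by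
  have hrel : ∀ ⦃x y⦄, OSRel K A x y →
      (RingQuot.mkAlgHom K (OSRel K B)).comp
        (ExteriorAlgebra.map (Finsupp.lmapDomain K K e)) x =
      (RingQuot.mkAlgHom K (OSRel K B)).comp
        (ExteriorAlgebra.map (Finsupp.lmapDomain K K e)) y := by
    rintro _ _ ⟨S, hS⟩
    rw [AlgHom.comp_apply, AlgHom.comp_apply, boundary_map, map_zero, map_zero,
      RingQuot.mkAlgHom_rel K (OSRel.of (e ∘ S) (he S hS)), map_zero]
  refine ⟨RingQuot.liftAlgHom K ⟨_, hrel⟩, ?_⟩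
  ext a
  simp

/-- A bijection of the lines that preserves dependence in both directions induces a graded
isomorphism of Orlik–Solomon algebras. -/
theorem exists_graded_os_equiv (e : A ≃ B)
    (he : ∀ {p : ℕ} (S : Fin (p + 1) → A),
      Projectivization.Dependent (fun i => (S i : Projectivization ℝ (Fin 3 → ℝ))) ↔
      Projectivization.Dependent (fun i => (e (S i) : Projectivization ℝ (Fin 3 → ℝ)))) :
    ∃ φ : OS K A ≃ₐ[K] OS K B, ∀ k : ℕ, (OSDeg K A k).map φ.toLinearMap = OSDeg K B k := by
  obtain ⟨g, hg⟩ := exists_osMap (K := K) e (fun S => (he S).1)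
  obtain ⟨g', hg'⟩ := exists_osMap (K := K) (A := B) (B := A) e.symm (fun S hS => by
    rw [he]; simpa using hS)
  have h1 : ∀ a, g (osι K A a) = osι K B (Finsupp.lmapDomain K K e a) := fun a => by
    simpa [osι] using DFunLike.congr_fun hg (ExteriorAlgebra.ι K a)
  have h2 : ∀ a, g' (osι K B a) = osι K A (Finsupp.lmapDomain K K e.symm a) := fun a => by
    simpa [osι] using DFunLike.congr_fun hg' (ExteriorAlgebra.ι K a)
  have e1 : g.comp g' = AlgHom.id K _ := by
    apply os_algHom_ext
    intro a
    rw [AlgHom.comp_apply, h2, h1, Finsupp.lmapDomain_apply, Finsupp.lmapDomain_apply,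
      ← Finsupp.mapDomain_comp]
    simp
  have e2 : g'.comp g = AlgHom.id K _ := by
    apply os_algHom_ext
    intro a
    rw [AlgHom.comp_apply, h1, h2, Finsupp.lmapDomain_apply, Finsupp.lmapDomain_apply,
      ← Finsupp.mapDomain_comp]
    simp
  refine ⟨AlgEquiv.ofAlgHom g g' e1 e2, fun k => ?_⟩
  have hsurj : LinearMap.range (Finsupp.lmapDomain K K e) = ⊤ := by
    rw [LinearMap.range_eq_top]
    exact Finsupp.mapDomain_surjective e.surjective
  have hpow : (⋀[K]^k (A →₀ K)).map
      (ExteriorAlgebra.map (Finsupp.lmapDomain K K e)).toLinearMap = ⋀[K]^k (B →₀ K) := by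
    rw [Submodule.map_pow, ExteriorAlgebra.ι_range_map_map, hsurj,
      Submodule.map_top]
  have hlin : (AlgEquiv.ofAlgHom g g' e1 e2).toLinearMap ∘ₗ
      (RingQuot.mkAlgHom K (OSRel K A)).toLinearMap =
      (RingQuot.mkAlgHom K (OSRel K B)).toLinearMap ∘ₗ
        (ExteriorAlgebra.map (Finsupp.lmapDomain K K e)).toLinearMap :=
    LinearMap.ext fun z => DFunLike.congr_fun hg z
  rw [OSDeg, OSDeg, ← Submodule.map_comp, hlin, Submodule.map_comp, hpow]

/-- Three lines are concurrent (or two of them coincide). -/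
def Conc (a b c : Projectivization ℝ (Fin 3 → ℝ)) : Prop :=
  Projectivization.Dependent ![a, b, c]

theorem dependent_three (S : Fin 3 → Projectivization ℝ (Fin 3 → ℝ)) :
    Projectivization.Dependent S ↔ Conc (S 0) (S 1) (S 2) := by
  rw [Conc, ← fin_three_eta]

theorem dependent_of_three_lt {p : ℕ} (S : Fin (p + 4) → Projectivization ℝ (Fin 3 → ℝ)) :
    Projectivization.Dependent S := by
  rw [Projectivization.dependent_iff]
  intro h
  have := h.fintype_card_le_finrank
  simp at this

theorem conc_iff_det {a b c : Projectivization ℝ (Fin 3 → ℝ)} :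
    Conc a b c ↔ (Matrix.of ![a.rep, b.rep, c.rep]).det = 0 := by
  rw [Conc, Projectivization.dependent_iff]
  have : Projectivization.rep ∘ ![a, b, c] = ![a.rep, b.rep, c.rep] := by
    ext i; fin_cases i <;> rfl
  rw [this]
  have h := Matrix.linearIndependent_rows_iff_isUnit (A := Matrix.of ![a.rep, b.rep, c.rep])
  rw [Matrix.isUnit_iff_isUnit_det, isUnit_iff_ne_zero] at h
  exact (not_congr h).trans not_not

theorem conc_swap {a b c : Projectivization ℝ (Fin 3 → ℝ)} : Conc a b c ↔ Conc b a c := by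
  rw [conc_iff_det, conc_iff_det, Matrix.det_fin_three, Matrix.det_fin_three]
  constructor <;> intro h <;> simp at h ⊢ <;> linarith

theorem conc_swap' {a b c : Projectivization ℝ (Fin 3 → ℝ)} : Conc a b c ↔ Conc a c b := by
  rw [conc_iff_det, conc_iff_det, Matrix.det_fin_three, Matrix.det_fin_three]
  constructor <;> intro h <;> simp at h ⊢ <;> linarith

theorem conc_self (a c : Projectivization ℝ (Fin 3 → ℝ)) : Conc a a c := by
  rw [conc_iff_det, Matrix.det_fin_three]
  simp
  ring

/-- A labelling of a line arrangement by two copies of `ℤ/m`, for which the dependencies are those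
of the Böröczky arrangement. -/
structure Labelling (m : ℕ) (A : Arrangement) where
  x : ZMod m → A
  y : ZMod m → A
  bij : Function.Bijective (Sum.elim x y)
  xxy : ∀ i j s, i ≠ j → (Conc (x i) (x j) (y s) ↔ s = i + j)
  xxx : ∀ i j k, i ≠ j → j ≠ k → i ≠ k → ¬ Conc (x i) (x j) (x k)
  xyy : ∀ i s t, s ≠ t → ¬ Conc (x i) (y s) (y t)
  yyy : ∀ r s t, Conc (y r) (y s) (y t)

namespace Labelling

variable {m : ℕ}

/-- The labels of dependent triples. -/
def Rel : ZMod m ⊕ ZMod m → ZMod m ⊕ ZMod m → ZMod m ⊕ ZMod m → Prop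
  | .inl i, .inl j, .inl k => i = j ∨ j = k ∨ i = k
  | .inl i, .inl j, .inr s => i = j ∨ s = i + j
  | .inl i, .inr s, .inl j => i = j ∨ s = i + j
  | .inr s, .inl i, .inl j => i = j ∨ s = i + j
  | .inl _, .inr s, .inr t => s = t
  | .inr s, .inl _, .inr t => s = t
  | .inr s, .inr t, .inl _ => s = t
  | .inr _, .inr _, .inr _ => True

theorem conc_iff_xxy (l : Labelling m A) (i j s : ZMod m) :
    Conc (l.x i) (l.x j) (l.y s) ↔ i = j ∨ s = i + j := by
  by_cases h : i = j
  · subst h; simp [conc_self]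
  · simp [h, l.xxy i j s h]

theorem conc_iff_xyy (l : Labelling m A) (i s t : ZMod m) :
    Conc (l.x i) (l.y s) (l.y t) ↔ s = t := by
  by_cases h : s = t
  · subst h
    simp only [iff_true]
    rw [conc_swap, conc_swap']; exact conc_self _ _
  · simp [h, l.xyy i s t h]

theorem conc_iff_xxx (l : Labelling m A) (i j k : ZMod m) :
    Conc (l.x i) (l.x j) (l.x k) ↔ i = j ∨ j = k ∨ i = k := by
  constructor
  · intro h
    by_contra! hn
    exact l.xxx i j k hn.1 hn.2.1 hn.2.2 h
  · rintro (rfl | rfl | rfl)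
    · exact conc_self _ _
    · rw [conc_swap, conc_swap']; exact conc_self _ _
    · rw [conc_swap']; exact conc_self _ _

theorem conc_iff_rel (l : Labelling m A) (u v w : ZMod m ⊕ ZMod m) :
    Conc (Sum.elim l.x l.y u : A) (Sum.elim l.x l.y v : A) (Sum.elim l.x l.y w : A) ↔ Rel u v w := by
  rcases u with i | i <;> rcases v with j | j <;> rcases w with k | k <;>
    simp only [Sum.elim_inl, Sum.elim_inr, Rel]
  · exact l.conc_iff_xxx _ _ _
  · exact l.conc_iff_xxy _ _ _
  · rw [conc_swap']; exact l.conc_iff_xxy _ _ _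
  · exact l.conc_iff_xyy _ _ _
  · rw [conc_swap, conc_swap']; exact l.conc_iff_xxy _ _ _
  · rw [conc_swap]; exact l.conc_iff_xyy _ _ _
  · rw [conc_swap', conc_swap]; exact l.conc_iff_xyy _ _ _
  · simp only [iff_true]; exact l.yyy _ _ _

/-- In rank three the dependent tuples are determined by equality of lines and by concurrent
triples, since four lines are always dependent; `Rel` reads both off the labels alone. -/
theorem exists_graded_os_equiv (lA : Labelling m A) (lB : Labelling m B) :
    ∃ φ : OS K A ≃ₐ[K] OS K B, ∀ k : ℕ, (OSDeg K A k).map φ.toLinearMap = OSDeg K B k := by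
  let eA := Equiv.ofBijective _ lA.bij
  let eB := Equiv.ofBijective _ lB.bij
  have hc : ∀ a b c : A, Conc a b c ↔
      Conc (eB (eA.symm a)) (eB (eA.symm b)) (eB (eA.symm c)) := by
    intro a b c
    obtain ⟨u, rfl⟩ := eA.surjective a
    obtain ⟨v, rfl⟩ := eA.surjective b
    obtain ⟨w, rfl⟩ := eA.surjective c
    simp only [Equiv.symm_apply_apply]
    exact (lA.conc_iff_rel u v w).trans (lB.conc_iff_rel u v w).symm
  apply LineArr.exists_graded_os_equiv (eA.symm.trans eB)
  intro p S
  match p, S with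
  | 0, S => exact iff_of_false (not_dependent_one _) (not_dependent_one _)
  | 1, S =>
    rw [dependent_two, dependent_two, Subtype.coe_inj, Subtype.coe_inj]
    exact (Equiv.apply_eq_iff_eq _).symm
  | 2, S =>
    rw [dependent_three, dependent_three]
    exact hc _ _ _
  | p + 3, S => exact iff_of_true (dependent_of_three_lt _) (dependent_of_three_lt _)

end Labelling

end Matroid

/-! ### Resonance: large pencils as an obstruction to isomorphism -/

section Resonance

universe u

/-- Vectors indexed by the lines of a labelled arrangement which satisfy the resonance conditions
at all double and triple points span a space of dimension at most two, unless they vanish off the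
pencil. -/
theorem exists_span_pair_of_resonance {F W : Type*} [Field F] [CharZero F] [AddCommGroup W]
    [Module F W] {m : ℕ} [NeZero m] (x y : ZMod m → W)
    (h3 : ∀ i j, i ≠ j → x i + x j + y (i + j) = 0 ∨
      ∃ w, x i ∈ F ∙ w ∧ x j ∈ F ∙ w ∧ y (i + j) ∈ F ∙ w)
    (h2 : ∀ i, ∃ w, x i ∈ F ∙ w ∧ y (i + i) ∈ F ∙ w) (i₀ : ZMod m) (hx : x i₀ ≠ 0) :
    ∃ w, ∀ j, x j ∈ Submodule.span F {x i₀, w} ∧ y j ∈ Submodule.span F {x i₀, w} := by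
  set q := (F ∙ x i₀).mkQ with hq
  have hq0 : ∀ z, q z = 0 ↔ z ∈ F ∙ x i₀ := fun z => by
    rw [hq, Submodule.mkQ_apply, Submodule.Quotient.mk_eq_zero]
  have hw : ∀ w z, x i₀ ∈ F ∙ w → z ∈ F ∙ w → q z = 0 := by
    intro w z h1 h2
    rw [hq0]
    obtain ⟨a, ha⟩ := Submodule.mem_span_singleton.1 h1
    obtain ⟨b, rfl⟩ := Submodule.mem_span_singleton.1 h2
    have ha0 : a ≠ 0 := by rintro rfl; exact hx (by simpa using ha.symm)
    rw [← ha]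
    exact Submodule.mem_span_singleton.2 ⟨b * a⁻¹, by rw [smul_smul, mul_assoc, inv_mul_cancel₀ ha0,
      mul_one]⟩
  have hx0 : q (x i₀) = 0 := (hq0 _).2 (Submodule.mem_span_singleton_self _)
  -- Modulo `x i₀`, the conditions at the points of line `i₀` express every `y` through an `x`. This
  -- eliminates the pencil and leaves an almost additive function `Z` on `ℤ/m`.
  have hY : ∀ j, q (y (i₀ + j)) = - q (x j) := by
    intro j
    by_cases hj : i₀ = j
    · subst hj
      obtain ⟨w, h, h'⟩ := h2 i₀
      rw [hw w _ h h', hx0, neg_zero]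
    · rcases h3 i₀ j hj with h | ⟨w, h, h', h''⟩
      · have := congrArg q h
        rw [map_add, map_add, hx0, zero_add, map_zero] at this
        exact eq_neg_of_add_eq_zero_right this
      · rw [hw w _ h h', hw w _ h h'', neg_zero]
  set Z : ZMod m → W ⧸ (F ∙ x i₀) := fun j => q (x (i₀ + j)) with hZ
  have hsum : ∀ i j, i ≠ j → Z i + Z j = Z (i + j) ∨
      ∃ w, Z i ∈ F ∙ w ∧ Z j ∈ F ∙ w := by
    intro i j hij
    rcases h3 (i₀ + i) (i₀ + j) (by simpa using hij) with h | ⟨w, h, h', h''⟩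
    · left
      have := congrArg q h
      rw [map_add, map_add, add_assoc i₀ i, hY, map_zero, add_left_comm i i₀ j] at this
      exact add_neg_eq_zero.1 this
    · right
      refine ⟨q w, ?_, ?_⟩
      · have := Submodule.mem_map_of_mem (f := q) h
        rwa [Submodule.map_span, Set.image_singleton] at this
      · have := Submodule.mem_map_of_mem (f := q) h'
        rwa [Submodule.map_span, Set.image_singleton] at this
  have hdep : ∀ a b, ¬ LinearIndependent F ![Z a, Z b] := by
    intro a b hab
    have hp := LinearIndependent.pair_iff.1 hab
    -- If `Z a` and `Z b` are independent, then `Z a` is never parallel to `Z (k * a + b)`, so the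
    -- additive alternative of `hsum` applies at every step.
    have hk : ∀ k : ℕ, Z (k * a + b) = (k : F) • Z a + Z b := by
      intro k
      induction k with
      | zero => simp
      | succ k ih =>
        have hne : a ≠ k * a + b := by
          intro h
          rw [← h] at ih
          have := hp (k - 1) 1 (by
            rw [sub_smul, one_smul, one_smul, sub_add_eq_add_sub, ← ih, sub_self])
          exact one_ne_zero this.2
        rcases hsum a _ hne with h | ⟨w, h, h'⟩
        · rw [Nat.cast_succ, Nat.cast_succ, add_mul, one_mul, add_right_comm, add_comm _ a, ← h, ih,
            add_smul, one_smul]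
          abel
        · exfalso
          rw [ih] at h'
          obtain ⟨s, hs⟩ := Submodule.mem_span_singleton.1 h
          obtain ⟨t, ht⟩ := Submodule.mem_span_singleton.1 h'
          have h1 := hp (t - s * k) (-s) (by
            have : t • Z a = s • ((k : F) • Z a + Z b) := by
              rw [← ht, ← smul_comm t s w, hs]
            rw [sub_smul, this, smul_add, smul_smul, neg_smul]
            abel)
          have hs0 : s = 0 := neg_eq_zero.1 h1.2
          have := hp 1 0 (by rw [← hs, hs0]; simp)
          exact one_ne_zero this.1
    -- Going once around `ℤ/m` returns to `b` and yields `m • Z a = 0`, which characteristic zero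
    -- excludes.
    have h := hk m
    rw [ZMod.natCast_self, zero_mul, zero_add] at h
    have := hp m 0 (by rw [zero_smul, add_zero]; exact left_eq_add.1 ((add_comm _ _).trans h.symm |>.symm))
    exact NeZero.ne m (by exact_mod_cast this.1)
  have hw : ∃ w, ∀ j, q (x j) ∈ F ∙ q w := by
    by_cases hall : ∀ j, q (x j) = 0
    · exact ⟨0, fun j => by rw [hall]; exact zero_mem _⟩
    · push Not at hall
      obtain ⟨a, ha⟩ := hall
      refine ⟨x a, fun j => ?_⟩
      have hZx : ∀ j, Z (j - i₀) = q (x j) := fun j => by simp [hZ]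
      have := hdep (a - i₀) (j - i₀)
      rw [hZx, hZx, LinearIndependent.pair_iff' ha] at this
      push Not at this
      exact Submodule.mem_span_singleton.2 this
  obtain ⟨w, hw⟩ := hw
  have hlift : ∀ z, q z ∈ F ∙ q w → z ∈ Submodule.span F {x i₀, w} := by
    intro z hz
    obtain ⟨c, hc⟩ := Submodule.mem_span_singleton.1 hz
    have : q (z - c • w) = 0 := by rw [map_sub, map_smul, hc, sub_self]
    obtain ⟨d, hd⟩ := Submodule.mem_span_singleton.1 ((hq0 _).1 this)
    exact Submodule.mem_span_pair.2 ⟨d, c, by rw [hd, sub_add_cancel]⟩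
  refine ⟨w, fun j => ⟨hlift _ (hw j), hlift _ ?_⟩⟩
  have := hY (j - i₀)
  rw [add_sub_cancel] at this
  rw [this]
  exact neg_mem (hw _)

variable {K : Type u} [CommRing K] {A B : Arrangement}

/-- A set of lines which contains with any two lines every line of the arrangement through their
common point. -/
def IsFlat (X : Finset B) : Prop :=
  ∀ a b c : B, a ≠ b → a ∈ X → b ∈ X → Conc a b c → c ∈ X

theorem conc_of_perm {a b c : Projectivization ℝ (Fin 3 → ℝ)} (h : Conc a b c) :
    Conc b c a ∧ Conc a c b := by
  refine ⟨?_, conc_swap'.1 h⟩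
  rw [conc_swap', conc_swap]; exact h

open Classical in
/-- Two elements of degree one with product zero are parallel at each flat. -/
theorem IsFlat.mul_eq_mul {X : Finset B} (hX : IsFlat X) {h : B} (hh : h ∈ X)
    {x y : OS K B} (hx : (linearPart K B x).fst = 0) (hy : (linearPart K B y).fst = 0)
    (hxy : x * y = 0) :
    (∑ g ∈ X, (linearPart K B x).snd g) * (linearPart K B y).snd h =
      (linearPart K B x).snd h * ∑ g ∈ X, (linearPart K B y).snd g := by
  have := wedge_eq_zero_of_mul_eq_zero (K := K) (A := B) (∑ g ∈ X, Finsupp.lapply g)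
    (Finsupp.lapply h) ?_ hx hy hxy
  · simpa [LinearMap.sum_apply] using this
  · intro S hS
    rw [dependent_three] at hS
    have hα : ∀ g : B, (∑ g ∈ X, Finsupp.lapply (R := K) (M := K) g) (Finsupp.single g 1) =
        if g ∈ X then 1 else 0 := by
      intro g
      simp [LinearMap.sum_apply, Finsupp.single_apply]
    have hβ : ∀ g : B, Finsupp.lapply (R := K) (M := K) h (Finsupp.single g 1) =
        if g = h then 1 else 0 := by
      intro g
      simp [Finsupp.single_apply]
    rw [hα, hα, hα, hβ, hβ, hβ]
    generalize S 0 = i at *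
    generalize S 1 = j at *
    generalize S 2 = k at *
    have hne : ∀ g : B, g ∉ X → g ≠ h := by rintro g hg rfl; exact hg hh
    -- The critical cases have exactly two of the three lines in `X`: flatness excludes them unless
    -- the two coincide.
    by_cases hi : i ∈ X <;> by_cases hj : j ∈ X <;> by_cases hk : k ∈ X <;>
      simp only [hi, hj, hk, if_true, if_false, sub_self, zero_mul, mul_zero, sub_zero, zero_sub,
        neg_one_mul, mul_neg_one]
    · by_cases hij : i = j
      · subst hij; simp
      · exact absurd (hX i j k hij hi hj hS) hk
    · by_cases hik : i = k
      · subst hik; simp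
      · exact absurd (hX i k j hik hi hk (conc_of_perm hS).2) hj
    · simp [hne _ hj, hne _ hk]
    · by_cases hjk : j = k
      · subst hjk; simp [hne _ hi]
      · exact absurd (hX j k i hjk hj hk (conc_of_perm hS).1) hi
    · simp [hne _ hi, hne _ hk]
    · simp [hne _ hi, hne _ hj]

namespace Labelling

variable {m : ℕ} (l : Labelling m B)

theorem x_ne_y (i j : ZMod m) : l.x i ≠ l.y j := fun h => by
  have := l.bij.1 (a₁ := .inl i) (a₂ := .inr j) h
  cases this

theorem x_injective : Function.Injective l.x := fun i j h =>
  Sum.inl_injective (l.bij.1 (a₁ := .inl i) (a₂ := .inl j) h)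

-- The triple points of a labelled arrangement. With the double points of `isFlat_pair` they supply
-- all the resonance conditions that are needed.
open Classical in
theorem isFlat_triple {i j : ZMod m} (hij : i ≠ j) :
    IsFlat ({l.x i, l.x j, l.y (i + j)} : Finset B) := by
  suffices h : ∀ u v w : ZMod m ⊕ ZMod m, u ≠ v →
      (u = .inl i ∨ u = .inl j ∨ u = .inr (i + j)) →
      (v = .inl i ∨ v = .inl j ∨ v = .inr (i + j)) → Rel u v w →
      (w = .inl i ∨ w = .inl j ∨ w = .inr (i + j)) by
    intro p q r hpq hp hq hpqr
    obtain ⟨u, rfl⟩ := l.bij.2 p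
    obtain ⟨v, rfl⟩ := l.bij.2 q
    obtain ⟨w, rfl⟩ := l.bij.2 r
    have hmem : ∀ u, Sum.elim l.x l.y u ∈ ({l.x i, l.x j, l.y (i + j)} : Finset B) ↔
        (u = .inl i ∨ u = .inl j ∨ u = .inr (i + j)) := fun u => by
      rw [← l.bij.1.eq_iff, ← l.bij.1.eq_iff (a := u) (b := .inl j),
        ← l.bij.1.eq_iff (a := u) (b := .inr (i + j))]
      simp only [Finset.mem_insert, Finset.mem_singleton, Sum.elim_inl, Sum.elim_inr]
    rw [hmem] at hp hq ⊢
    exact h u v w (fun h => hpq (h ▸ rfl)) hp hq ((l.conc_iff_rel u v w).1 hpqr)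
  have hc := add_comm i j
  rintro u v (w | w) huv (rfl | rfl | rfl) (rfl | rfl | rfl) h <;> simp only [Rel] at h <;> grind

open Classical in
theorem isFlat_pair (i : ZMod m) : IsFlat ({l.x i, l.y (i + i)} : Finset B) := by
  suffices h : ∀ u v w : ZMod m ⊕ ZMod m, u ≠ v → (u = .inl i ∨ u = .inr (i + i)) →
      (v = .inl i ∨ v = .inr (i + i)) → Rel u v w → (w = .inl i ∨ w = .inr (i + i)) by
    intro p q r hpq hp hq hpqr
    obtain ⟨u, rfl⟩ := l.bij.2 p
    obtain ⟨v, rfl⟩ := l.bij.2 q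
    obtain ⟨w, rfl⟩ := l.bij.2 r
    have hmem : ∀ u, Sum.elim l.x l.y u ∈ ({l.x i, l.y (i + i)} : Finset B) ↔
        (u = .inl i ∨ u = .inr (i + i)) := fun u => by
      rw [← l.bij.1.eq_iff, ← l.bij.1.eq_iff (a := u) (b := .inr (i + i))]
      simp only [Finset.mem_insert, Finset.mem_singleton, Sum.elim_inl, Sum.elim_inr]
    rw [hmem] at hp hq ⊢
    exact h u v w (fun h => hpq (h ▸ rfl)) hp hq ((l.conc_iff_rel u v w).1 hpqr)
  rintro u v (w | w) huv (rfl | rfl) (rfl | rfl) h <;> simp only [Rel] at h <;> grind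

end Labelling

/-- The constant term is multiplicative and a domain has no nilpotents. This makes the linear part
usable for isomorphisms that do not respect the grading. -/
theorem linearPart_fst_eq_zero [IsDomain K] {x : OS K B} (hx : x * x = 0) :
    (linearPart K B x).fst = 0 := by
  have := congrArg (fun z => (linearPart K B z).fst) hx
  simpa using this

/-- The linear part of an isomorphism of Orlik–Solomon algebras. -/
noncomputable def linearize (φ : OS K A →ₐ[K] OS K B) : (A →₀ K) →ₗ[K] (B →₀ K) :=
  TrivSqZeroExt.sndHom K (B →₀ K) ∘ₗ (linearPart K B).toLinearMap ∘ₗ φ.toLinearMap ∘ₗ osι K A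

theorem linearize_apply (φ : OS K A →ₐ[K] OS K B) (a : A →₀ K) :
    linearize φ a = (linearPart K B (φ (osι K A a))).snd := rfl

theorem fst_linearPart_map [IsDomain K] (φ : OS K A →ₐ[K] OS K B) (a : A →₀ K) :
    (linearPart K B (φ (osι K A a))).fst = 0 :=
  linearPart_fst_eq_zero (by rw [← map_mul, osι_mul_self, map_zero])

theorem linearPart_map [IsDomain K] (φ : OS K A →ₐ[K] OS K B) (x : OS K A) :
    linearPart K B (φ x) = TrivSqZeroExt.map (linearize φ) (linearPart K A x) := by
  have : (linearPart K B).comp φ = (TrivSqZeroExt.map (linearize φ)).comp (linearPart K A) := by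
    apply os_algHom_ext
    intro a
    simp only [AlgHom.comp_apply, linearPart_osι, TrivSqZeroExt.map_inr]
    ext1
    · rw [fst_linearPart_map, TrivSqZeroExt.fst_inr]
    · rw [TrivSqZeroExt.snd_inr, linearize_apply]
  exact DFunLike.congr_fun this x

/-- Constant terms stay zero under `φ`, so taking linear parts respects composition, and the linear
part of `φ.symm` is a left inverse. -/
theorem linearize_injective [IsDomain K] (φ : OS K A ≃ₐ[K] OS K B) :
    Function.Injective (linearize (φ : OS K A →ₐ[K] OS K B)) := by
  apply Function.LeftInverse.injective (g := linearize (φ.symm : OS K B →ₐ[K] OS K A))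
  intro a
  have h := linearPart_map (φ.symm : OS K B →ₐ[K] OS K A) (φ (osι K A a))
  have h' := congrArg TrivSqZeroExt.snd h
  simpa [linearize_apply] using h'.symm

/-- Restricting to the coordinates in `I` kills the subtracted terms and leaves the standard basis.
-/
theorem linearIndependent_single_sub {ι : Type*} (I : Finset ι) (b : ι → ι)
    (hb : ∀ i ∈ I, b i ∉ I) :
    LinearIndependent K
      (fun i : I => (Finsupp.single (i : ι) (1 : K) - Finsupp.single (b i) 1 : ι →₀ K)) := by
  classical
  apply LinearIndependent.of_comp
    (Finsupp.lcomapDomain (M := K) (R := K) ((↑) : I → ι) Subtype.val_injective)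
  convert! (Finsupp.basisSingleOne (R := K) (ι := I)).linearIndependent using 1
  ext i j
  have : b i ≠ j := fun h => hb i i.2 (h ▸ j.2)
  simp [Finsupp.single_apply, this]

variable [IsDomain K] [CharZero K] {m : ℕ} [NeZero m]

-- The differences `e_i - e_b` in a pencil of at least four lines span dimension at least three and
-- multiply to zero in pairs. A nonzero coordinate at some `x j` would, by
-- `exists_span_pair_of_resonance`, bound the dimension of their image by two, against injectivity.
open Classical in
theorem linearize_apply_x_eq_zero (l : Labelling m B) (φ : OS K A ≃ₐ[K] OS K B)
    (X : Finset A) (hX : ∀ a ∈ X, ∀ b ∈ X, ∀ c ∈ X, Conc a b c) (hcard : 4 ≤ X.card)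
    {i b : A} (hi : i ∈ X) (hb : b ∈ X) (hib : i ≠ b) (j : ZMod m) :
    linearize (φ : OS K A →ₐ[K] OS K B) (Finsupp.single i 1 - Finsupp.single b 1) (l.x j) = 0 := by
  set Φ := linearize (φ : OS K A →ₐ[K] OS K B) with hΦ
  set I := X.erase b with hI
  have hbI : b ∉ I := Finset.notMem_erase b X
  have hIX : ∀ i ∈ I, i ∈ X := fun i hi => Finset.mem_of_mem_erase hi
  have hIcard : 3 ≤ Fintype.card I := by
    rw [Fintype.card_coe, hI, Finset.card_erase_of_mem hb]; omega
  let u : I → (A →₀ K) := fun i => Finsupp.single (i : A) 1 - Finsupp.single b 1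
  have hu : LinearIndependent K u := linearIndependent_single_sub I (fun _ => b) (fun _ _ => hbI)
  have hprod : ∀ r s, osι K A (u r) * osι K A (u s) = 0 := fun r s =>
    osι_sub_mul_sub ![b, r, s] ((dependent_three _).2 (hX _ hb _ (hIX _ r.2) _ (hIX _ s.2)))
  let F := FractionRing K
  -- These are the columns of the matrix with rows `Φ (u r)`: resonance constrains the columns,
  -- independence concerns the rows.
  let v : B → I → F := fun g r => algebraMap K F (Φ (u r) g)
  have hflat : ∀ Y : Finset B, IsFlat Y → (∑ g ∈ Y, v g = 0) ∨
      ∀ h ∈ Y, v h ∈ F ∙ (∑ g ∈ Y, v g) := by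
    intro Y hY
    refine or_iff_not_imp_left.2 fun hne h hh => ?_
    obtain ⟨r, hr⟩ := Function.ne_iff.1 hne
    refine Submodule.mem_span_singleton.2 ⟨v h r * ((∑ g ∈ Y, v g) r)⁻¹, ?_⟩
    ext s
    have key := hY.mul_eq_mul hh (fst_linearPart_map (φ : OS K A →ₐ[K] OS K B) (u r))
      (fst_linearPart_map (φ : OS K A →ₐ[K] OS K B) (u s))
      (by rw [← map_mul, hprod, map_zero])
    have key' := congrArg (algebraMap K F) key
    rw [map_mul, map_mul, map_sum, map_sum] at key'
    have key2 : (∑ g ∈ Y, v g) r * v h s = v h r * (∑ g ∈ Y, v g) s := by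
      simp only [Finset.sum_apply]
      exact key'
    have hr' : (∑ g ∈ Y, v g) r ≠ 0 := hr
    rw [Pi.smul_apply, smul_eq_mul]
    rw [mul_right_comm, ← key2, mul_comm _ (v h s), mul_inv_cancel_right₀ hr']
  by_contra hne
  have hiI : i ∈ I := Finset.mem_erase.2 ⟨hib, hi⟩
  have hvne : v (l.x j) ≠ 0 := by
    intro h
    apply hne
    have := congrFun h ⟨i, hiI⟩
    exact (FaithfulSMul.algebraMap_injective K F) (by simpa [v, u] using this)
  obtain ⟨w, hw⟩ := exists_span_pair_of_resonance (F := F) (fun i => v (l.x i)) (fun i => v (l.y i))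
    (by
      intro i j hij
      have hs : ∑ g ∈ ({l.x i, l.x j, l.y (i + j)} : Finset B), v g =
          v (l.x i) + v (l.x j) + v (l.y (i + j)) := by
        rw [Finset.sum_insert, Finset.sum_insert, Finset.sum_singleton, add_assoc]
        · simp [l.x_ne_y]
        · simp only [Finset.mem_insert, Finset.mem_singleton, l.x_ne_y, or_false]
          exact fun h => hij (l.x_injective h)
      rcases hflat _ (l.isFlat_triple hij) with h | h
      · exact Or.inl (hs ▸ h)
      · exact Or.inr ⟨_, h _ (by simp), h _ (by simp), h _ (by simp)⟩)
    (by
      intro i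
      have hs : ∑ g ∈ ({l.x i, l.y (i + i)} : Finset B), v g = v (l.x i) + v (l.y (i + i)) :=
        Finset.sum_pair (l.x_ne_y _ _)
      rcases hflat _ (l.isFlat_pair i) with h | h
      · rw [hs] at h
        exact ⟨v (l.x i), Submodule.mem_span_singleton_self _, by
          rw [eq_neg_of_add_eq_zero_right h]
          exact neg_mem (Submodule.mem_span_singleton_self _)⟩
      · exact ⟨_, h _ (by simp), h _ (by simp)⟩) j hvne
  have hvspan : ∀ g, v g ∈ Submodule.span F {v (l.x j), w} := by
    intro g
    obtain ⟨t | t, rfl⟩ := l.bij.2 g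
    · exact (hw t).1
    · exact (hw t).2
  let incl : (B →₀ K) →ₗ[K] (B → F) :=
    { toFun := fun a g => algebraMap K F (a g)
      map_add' := fun a b => by ext; simp
      map_smul' := fun c a => by ext; simp [Algebra.smul_def] }
  have hincl : Function.Injective incl := fun a b hab => by
    ext g
    exact FaithfulSMul.algebraMap_injective K F (congrFun hab g)
  have hLI : LinearIndependent K (fun r => incl (Φ (u r))) :=
    (hu.map' Φ (LinearMap.ker_eq_bot.2 (linearize_injective φ))).map' incl
      (LinearMap.ker_eq_bot.2 hincl)
  have hLIF : LinearIndependent F (fun r => incl (Φ (u r))) :=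
    (LinearIndependent.iff_fractionRing K F).1 hLI
  -- Row rank is at least three, while all columns lie in the span of two vectors.
  have hrank := LinearIndependent.rank_matrix (M := Matrix.of fun r => incl (Φ (u r))) hLIF
  rw [Matrix.rank_eq_finrank_span_cols] at hrank
  have hle : Submodule.span F (Set.range (Matrix.of fun r => incl (Φ (u r))).col) ≤
      Submodule.span F {v (l.x j), w} := by
    rw [Submodule.span_le]
    rintro _ ⟨g, rfl⟩
    exact hvspan g
  have h1 := Submodule.finrank_mono hle
  have h2 : Module.finrank F (Submodule.span F {v (l.x j), w}) ≤ 2 :=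
    (finrank_span_le_card ({v (l.x j), w} : Set (I → F))).trans (by
      rw [Set.toFinset_insert, Set.toFinset_singleton]; exact Finset.card_le_two)
  omega

open Classical in
/-- An arrangement with two points of multiplicity at least four, one of them of multiplicity `m`,
does not have the Orlik–Solomon algebra of a labelled arrangement. -/
theorem not_os_equiv_labelling (l : Labelling m B) (φ : OS K A ≃ₐ[K] OS K B) (X Y : Finset A)
    (hX : ∀ a ∈ X, ∀ b ∈ X, ∀ c ∈ X, Conc a b c)
    (hY : ∀ a ∈ Y, ∀ b ∈ Y, ∀ c ∈ Y, Conc a b c)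
    (hXm : X.card = m) (hX4 : 4 ≤ X.card) (hY4 : 4 ≤ Y.card) (hXY : (Y ∩ X).card ≤ 1) : False := by
  have hdiff : 2 < (Y \ X).card := by
    have := Finset.card_sdiff_add_card_inter Y X
    omega
  obtain ⟨b, c, d, hb, hc, hd, hbc, hbd, hcd⟩ := Finset.two_lt_card_iff.1 hdiff
  rw [Finset.mem_sdiff] at hb hc hd
  obtain ⟨a, ha⟩ : X.Nonempty := Finset.card_pos.1 (by omega)
  -- The differences against `a` inside `X` number `m - 1`, and `c - b`, `d - b` from `Y \ X` add
  -- two. The images of all `m + 1` vanish on the lines `x`.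
  set I : Finset A := (X.erase a) ∪ {c, d} with hI
  set base : A → A := fun i => if i ∈ X then a else b with hbase
  have hbI : ∀ i ∈ I, base i ∉ I := by
    intro i _
    simp only [hbase]
    split_ifs
    · simp only [hI, Finset.mem_union, Finset.mem_erase, ne_eq, not_true_eq_false, false_and,
        Finset.mem_insert, Finset.mem_singleton, false_or]
      rintro (rfl | rfl)
      · exact hc.2 ha
      · exact hd.2 ha
    · simp [hI, hb.2, hbc, hbd]
  have hIcard : I.card = m + 1 := by
    rw [hI, Finset.card_union_of_disjoint, Finset.card_erase_of_mem ha, Finset.card_pair hcd]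
    · omega
    · rw [Finset.disjoint_right]
      intro z hz hz'
      have hzX := Finset.mem_of_mem_erase hz'
      simp only [Finset.mem_insert, Finset.mem_singleton] at hz
      rcases hz with rfl | rfl
      · exact hc.2 hzX
      · exact hd.2 hzX
  set Φ := linearize (φ : OS K A →ₐ[K] OS K B)
  have hvanish : ∀ i ∈ I, ∀ j, Φ (Finsupp.single i 1 - Finsupp.single (base i) 1) (l.x j) = 0 := by
    intro i hi j
    simp only [hI, Finset.mem_union, Finset.mem_erase, Finset.mem_insert,
      Finset.mem_singleton] at hi
    rcases hi with ⟨hia, hiX⟩ | rfl | rfl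
    · simp only [hbase, if_pos hiX]
      exact linearize_apply_x_eq_zero l φ X hX hX4 hiX ha hia j
    · simp only [hbase, if_neg hc.2]
      exact linearize_apply_x_eq_zero l φ Y hY hY4 hc.1 hb.1 hbc.symm j
    · simp only [hbase, if_neg hd.2]
      exact linearize_apply_x_eq_zero l φ Y hY hY4 hd.1 hb.1 hbd.symm j
  let res : (B →₀ K) →ₗ[K] (ZMod m → K) := LinearMap.pi fun s => Finsupp.lapply (l.y s)
  have hLI := linearIndependent_single_sub (K := K) I base hbI
  have hLI' := hLI.map' Φ (LinearMap.ker_eq_bot.2 (linearize_injective φ))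
  have hLI'' := hLI'.map_injOn res (by
    have hzero : ∀ z ∈ Submodule.span K (Set.range (Φ ∘ fun i : I =>
        (Finsupp.single (i : A) (1 : K) - Finsupp.single (base i) 1 : A →₀ K))),
        ∀ j, z (l.x j) = 0 := by
      intro z hz j
      induction hz using Submodule.span_induction with
      | mem z hz => obtain ⟨i, rfl⟩ := hz; exact hvanish i i.2 j
      | zero => rfl
      | add y z _ _ hy hz => rw [Finsupp.add_apply, hy, hz, add_zero]
      | smul c z _ hz => rw [Finsupp.smul_apply, hz, smul_zero]
    intro z hz z' hz' h
    ext g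
    obtain ⟨t | t, rfl⟩ := l.bij.2 g
    · exact (hzero z hz t).trans (hzero z' hz' t).symm
    · exact congrFun h t)
  have := hLI''.fintype_card_le_finrank
  simp [ZMod.card, hIcard] at this

end Resonance

/-! ### Comonotone height functions and their level counts -/

section Directions

variable {S : Type*}

/-- Two height functions never order a pair of points in strictly opposite ways. -/
def Comono (f g : S → ℝ) : Prop := ∀ p q, f p < f q → g p ≤ g q

/-- Two height functions jointly separate points. -/
def JointInj (f g : S → ℝ) : Prop := ∀ p q, f p = f q → g p = g q → p = q

theorem Comono.symm {f g : S → ℝ} (h : Comono f g) : Comono g f := fun p q hpq => by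
  by_contra! hn
  exact absurd (h q p hn) (not_le.2 hpq)

theorem JointInj.symm {f g : S → ℝ} (h : JointInj f g) : JointInj g f :=
  fun p q h1 h2 => h p q h2 h1

-- Comonotonicity makes both heights weakly increasing along the order by `f + g`, and joint
-- injectivity makes at least one increase strictly at each step. Every point after the first thus
-- contributes a new value of `f` or of `g`.
open Classical in
theorem card_add_one_le_card_image_add {f g : S → ℝ} (hc : Comono f g) (hj : JointInj f g)
    (s : Finset S) (hs : s.Nonempty) : s.card + 1 ≤ (s.image f).card + (s.image g).card := by
  induction s using Finset.induction_on_max_value (fun p => f p + g p) with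
  | empty => exact absurd hs (by simp)
  | insert p s hp hmax ih =>
    rcases s.eq_empty_or_nonempty with rfl | hne
    · simp
    · have ih := ih hne
      obtain ⟨q, hq, hqmax⟩ := s.exists_max_image (fun p => f p + g p) hne
      have hle : ∀ x y, f x + g x ≤ f y + g y → f x ≤ f y ∧ g x ≤ g y := by
        intro x y h
        constructor
        · by_contra! hn
          have := hc _ _ hn
          linarith
        · by_contra! hn
          have := hc.symm _ _ hn
          linarith
      have hpq : q ≠ p := fun h => hp (h ▸ hq)
      rw [Finset.card_insert_of_notMem hp, Finset.image_insert, Finset.image_insert]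
      have hqp := hle q p (hmax q hq)
      rcases hqp.1.lt_or_eq with h | h
      · have hf : f p ∉ s.image f := by
          intro hm
          obtain ⟨z, hz, hzp⟩ := Finset.mem_image.1 hm
          have := (hle z q (hqmax z hz)).1
          linarith
        rw [Finset.card_insert_of_notMem hf]
        have := Finset.card_le_card (Finset.subset_insert (g p) (s.image g))
        omega
      · have h' : g q < g p := hqp.2.lt_of_ne fun h' => hpq (hj _ _ h h')
        have hg : g p ∉ s.image g := by
          intro hm
          obtain ⟨z, hz, hzp⟩ := Finset.mem_image.1 hm
          have := (hle z q (hqmax z hz)).2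
          linarith
        rw [Finset.card_insert_of_notMem hg]
        have := Finset.card_le_card (Finset.subset_insert (f p) (s.image f))
        omega

/-- Points that are consecutive for the common order have one of the two heights in common. -/
def Tight (f g : S → ℝ) : Prop :=
  ∀ p q, f p + g p < f q + g q →
    (∀ z, f z + g z ≤ f p + g p ∨ f q + g q ≤ f z + g z) → f p = f q ∨ g p = g q

theorem Tight.symm {f g : S → ℝ} (h : Tight f g) : Tight g f := fun p q hpq hz =>
  (h p q (by linarith) (fun z => by
    rcases hz z with h | h
    · left; linarith
    · right; linarith)).symm

-- If both heights jumped between consecutive points, cutting there would give two sets with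
-- disjoint values of `f` and of `g`. The lower bound for each part would add up to `Fintype.card S
-- + 2`.
open Classical in
theorem tight_of_card_le [Fintype S] {f g : S → ℝ} (hc : Comono f g) (hj : JointInj f g)
    (h : (Finset.univ.image f).card + (Finset.univ.image g).card ≤ Fintype.card S + 1) :
    Tight f g := by
  intro p q hpq hz
  by_contra! hn
  have hfl : f p < f q := by
    refine lt_of_le_of_ne ?_ hn.1
    by_contra! hlt
    have := hc _ _ hlt
    linarith
  have hgl : g p < g q := by
    refine lt_of_le_of_ne ?_ hn.2
    by_contra! hlt
    have := hc.symm _ _ hlt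
    linarith
  have hle : ∀ x y, f x + g x ≤ f y + g y → f x ≤ f y ∧ g x ≤ g y := by
    intro x y h
    constructor
    · by_contra! hn
      have := hc _ _ hn
      linarith
    · by_contra! hn
      have := hc.symm _ _ hn
      linarith
  set U := Finset.univ.filter fun z => f z + g z ≤ f p + g p with hU
  set V := Finset.univ.filter fun z => f q + g q ≤ f z + g z with hV
  have hUV : U ∪ V = Finset.univ := by
    ext z; simpa [hU, hV] using hz z
  have hdisj : Disjoint U V := by
    rw [Finset.disjoint_left]
    intro z h1 h2
    rw [hU, Finset.mem_filter] at h1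
    rw [hV, Finset.mem_filter] at h2
    linarith [h1.2, h2.2]
  have hcard : Fintype.card S = U.card + V.card := by
    rw [← Finset.card_univ, ← hUV, Finset.card_union_of_disjoint hdisj]
  have h1 := card_add_one_le_card_image_add hc hj U ⟨p, by simp [hU]⟩
  have h2 := card_add_one_le_card_image_add hc hj V ⟨q, by simp [hV]⟩
  have hUm : ∀ z ∈ U, f z ≤ f p ∧ g z ≤ g p := fun z hz =>
    hle _ _ (by simpa [hU] using hz)
  have hVm : ∀ z ∈ V, f q ≤ f z ∧ g q ≤ g z := fun z hz =>
    hle _ _ (by simpa [hV] using hz)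
  have hf : (Finset.univ.image f).card = (U.image f).card + (V.image f).card := by
    rw [← hUV, Finset.image_union, Finset.card_union_of_disjoint]
    rw [Finset.disjoint_left]
    intro v h1 h2
    obtain ⟨z, hz, rfl⟩ := Finset.mem_image.1 h1
    obtain ⟨z', hz', h⟩ := Finset.mem_image.1 h2
    linarith [(hUm z hz).1, (hVm z' hz').1]
  have hg : (Finset.univ.image g).card = (U.image g).card + (V.image g).card := by
    rw [← hUV, Finset.image_union, Finset.card_union_of_disjoint]
    rw [Finset.disjoint_left]
    intro v h1 h2
    obtain ⟨z, hz, rfl⟩ := Finset.mem_image.1 h1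
    obtain ⟨z', hz', h⟩ := Finset.mem_image.1 h2
    linarith [(hUm z hz).2, (hVm z' hz').2]
  omega

/-- `r` exchanges the points of each fibre of `f`, all of which have at most two elements. -/
def IsPartner (f : S → ℝ) (r : S → S) : Prop := ∀ p q, f p = f q ↔ q = p ∨ q = r p

theorem IsPartner.apply_eq {f : S → ℝ} {r : S → S} (h : IsPartner f r) (p : S) :
    f (r p) = f p := ((h p (r p)).2 (Or.inr rfl)).symm

theorem IsPartner.involutive {f : S → ℝ} {r : S → S} (h : IsPartner f r) :
    Function.Involutive r := by
  intro p
  rcases (h (r p) p).1 (h.apply_eq p) with h' | h'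
  · rw [← h', ← h']
  · exact h'.symm

theorem exists_isPartner {f : S → ℝ}
    (hf : ∀ p q z, f p = f q → f p = f z → p = q ∨ p = z ∨ q = z) : ∃ r, IsPartner f r := by
  have : ∀ p, ∃ r, ∀ q, f p = f q ↔ q = p ∨ q = r := by
    intro p
    by_cases h : ∃ z, z ≠ p ∧ f p = f z
    · obtain ⟨z, hz, hpz⟩ := h
      refine ⟨z, fun q => ⟨fun hq => ?_, ?_⟩⟩
      · rcases hf p q z hq hpz with h | h | h
        · exact Or.inl h.symm
        · exact absurd h.symm hz
        · exact Or.inr h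
      · rintro (rfl | rfl)
        · rfl
        · exact hpz
    · push Not at h
      refine ⟨p, fun q => ⟨fun hq => ?_, ?_⟩⟩
      · left
        by_contra hn
        exact h q hn hq
      · rintro (rfl | rfl) <;> rfl
  choose r hr using this
  exact ⟨r, hr⟩

/-! ### The relation between the involutions of three consecutive directions -/

section Braid

variable {f g k : S → ℝ} {rf rg rk : S → S}

/-- The levels of `g` through `p` and `rf p` are adjacent, as a point strictly between them would
share their `f`. When `g p < g (rf p)`, in the order by `g + k` the last point of the lower level is
`rg p` and the first of the upper one is `rg (rf p)`. Tightness makes their `k`-heights equal, since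
their `g`-heights differ. -/
theorem braid_of_ne (hfg : Comono f g) (hgk : Comono g k) (jfg : JointInj f g)
    (tgk : Tight g k) (pf : IsPartner f rf) (pg : IsPartner g rg) (pk : IsPartner k rk)
    {c d : ℝ} (hc : 0 < c) (hd : 0 < d) (hcd : ∀ p, g p = c * f p + d * k p) {p : S}
    (hp : rf p ≠ p) : rk (rg p) = rg (rf p) := by
  suffices main : ∀ p, rf p ≠ p → g p < g (rf p) → rk (rg p) = rg (rf p) by
    have hne : g p ≠ g (rf p) := fun h => hp (jfg _ _ (pf.apply_eq p) h.symm)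
    rcases hne.lt_or_gt with h | h
    · exact main p hp h
    · have := main (rf p) (by rw [pf.involutive p]; exact hp.symm) (by rwa [pf.involutive p])
      rw [pf.involutive p] at this
      rw [← this, pk.involutive]
  intro p hp hlt
  have e1 : g (rg p) = g p := pg.apply_eq p
  have e2 : g (rg (rf p)) = g (rf p) := pg.apply_eq _
  have e3 : f (rf p) = f p := pf.apply_eq p
  have hle : ∀ x y, g x + k x ≤ g y + k y → g x ≤ g y := by
    intro x y h
    by_contra! hn
    have := hgk _ _ hn
    linarith
  have hkk := hgk (rg p) (rg (rf p)) (by rw [e1, e2]; exact hlt)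
  have hcons := tgk (rg p) (rg (rf p)) (by rw [e1, e2]; linarith) (by
    intro z
    by_contra! hn
    obtain ⟨hn1, hn2⟩ := hn
    have h1 : g p ≤ g z := e1 ▸ hle _ _ hn1.le
    have h2 : g z ≤ g (rf p) := e2 ▸ hle _ _ hn2.le
    rcases h1.lt_or_eq with h1 | h1
    · rcases h2.lt_or_eq with h2 | h2
      · have h3 := hfg.symm _ _ h1
        have h4 := hfg.symm _ _ h2
        rcases (pf p z).1 (by linarith) with rfl | rfl
        · exact lt_irrefl _ h1
        · exact lt_irrefl _ h2
      · rcases (pg (rf p) z).1 h2.symm with rfl | rfl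
        -- On a level of `g`, the positive combination `hcd` orders `f` and `k` oppositely.
        · have h5 : f (rg (rf p)) < f (rf p) := by
            have a1 := hcd (rf p)
            have a2 := hcd (rg (rf p))
            have : d * k (rf p) < d * k (rg (rf p)) := mul_lt_mul_of_pos_left (by linarith) hd
            have : c * f (rg (rf p)) < c * f (rf p) := by linarith
            exact lt_of_mul_lt_mul_left this hc.le
          have := hfg (rg (rf p)) p (by linarith)
          linarith
        · exact lt_irrefl _ hn2
    · rcases (pg p z).1 h1 with rfl | rfl
      · have h5 : f z < f (rg z) := by
          have a1 := hcd z
          have a2 := hcd (rg z)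
          have : d * k (rg z) < d * k z := mul_lt_mul_of_pos_left (by linarith) hd
          have : c * f z < c * f (rg z) := by linarith
          exact lt_of_mul_lt_mul_left this hc.le
        have := hfg (rf z) (rg z) (by linarith)
        linarith
      · exact lt_irrefl _ hn1)
  rcases hcons with h | h
  · rw [e1, e2] at h
    exact absurd h hlt.ne
  · rcases (pk _ _).1 h with h' | h'
    · rw [h', e1] at e2
      exact absurd e2 hlt.ne
    · exact h'.symm

/-- When `rf` fixes `p`, the relation could fail only if `rk` moved `rg p`; the previous lemma with
`f` and `k` exchanged, applied at `rg p`, excludes this. -/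
theorem braid (hfg : Comono f g) (hgk : Comono g k) (jfg : JointInj f g) (jgk : JointInj g k)
    (tfg : Tight f g) (tgk : Tight g k)
    (pf : IsPartner f rf) (pg : IsPartner g rg) (pk : IsPartner k rk)
    {c d : ℝ} (hc : 0 < c) (hd : 0 < d) (hcd : ∀ p, g p = c * f p + d * k p) (p : S) :
    rk (rg p) = rg (rf p) := by
  by_cases hp : rf p = p
  · by_cases hq : rk (rg p) = rg p
    · rw [hp, hq]
    · have := braid_of_ne hgk.symm hfg.symm jgk.symm tfg.symm pk pg pf hd hc
        (fun p => by rw [hcd, add_comm]) hq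
      rw [pg.involutive, hp] at this
      have := congrArg rg this
      rw [pg.involutive] at this
      exact absurd this.symm hq
  · exact braid_of_ne hfg hgk jfg tgk pf pg pk hc hd hcd hp

/-- Take the lowest point for `f + g`. Two proper partners of it would be ordered oppositely by `f`
and `g`. By tightness every other point is a partner of its immediate predecessor, so the whole set
is reached from the lowest point. -/
theorem exists_fixed_generating [Fintype S] [Nonempty S] (hfg : Comono f g) (jfg : JointInj f g)
    (tfg : Tight f g) (pf : IsPartner f rf) (pg : IsPartner g rg) :
    ∃ q, (rf q = q ∨ rg q = q) ∧
      ∀ T : Set S, q ∈ T → (∀ p ∈ T, rf p ∈ T) → (∀ p ∈ T, rg p ∈ T) → T = Set.univ := by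
  classical
  obtain ⟨q, -, hq⟩ := Finset.univ.exists_min_image (fun p => f p + g p)
    (Finset.univ_nonempty (α := S))
  have hinj : ∀ x y, f x + g x = f y + g y → x = y := by
    intro x y h
    rcases lt_trichotomy (f x) (f y) with h1 | h1 | h1
    · have := hfg _ _ h1; linarith
    · exact jfg _ _ h1 (by linarith)
    · have := hfg _ _ h1; linarith
  refine ⟨q, ?_, fun T hqT hf hg => ?_⟩
  · by_contra! hn
    have e1 := pf.apply_eq q
    have e2 := pg.apply_eq q
    have h1 : f q + g q ≤ f (rf q) + g (rf q) := hq _ (Finset.mem_univ _)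
    have h2 : f q + g q ≤ f (rg q) + g (rg q) := hq _ (Finset.mem_univ _)
    have h3 : f (rf q) < f (rg q) := by
      refine lt_of_le_of_ne (by linarith) fun h => hn.2 (jfg _ _ ?_ e2)
      rw [← h, e1]
    have h4 := hfg _ _ h3
    exact hn.1 (jfg _ _ e1 (by linarith))
  · have hfin : ∀ n : ℕ, ∀ x, (Finset.univ.filter fun z => f z + g z < f x + g x).card = n →
        x ∈ T := by
      intro n
      induction n using Nat.strong_induction_on with
      | _ n ih =>
        intro x hx
        by_cases hxq : x = q
        · exact hxq ▸ hqT
        · have hne : (Finset.univ.filter fun z => f z + g z < f x + g x).Nonempty := by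
            refine ⟨q, ?_⟩
            simp only [Finset.mem_filter, Finset.mem_univ, true_and]
            exact lt_of_le_of_ne (hq x (Finset.mem_univ _)) fun h => hxq (hinj _ _ h).symm
          obtain ⟨y, hy, hymax⟩ := Finset.exists_max_image _ (fun p => f p + g p) hne
          simp only [Finset.mem_filter, Finset.mem_univ, true_and] at hy hymax
          have hyT : y ∈ T := by
            refine ih _ ?_ y rfl
            rw [← hx]
            apply Finset.card_lt_card
            rw [Finset.ssubset_iff_of_subset]
            · exact ⟨y, by simpa using hy, by simp⟩
            · intro z hz
              simp only [Finset.mem_filter, Finset.mem_univ, true_and] at hz ⊢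
              linarith
          rcases tfg y x hy (fun z => by
            by_contra! hn
            exact absurd (hymax z hn.2) (not_le.2 hn.1)) with h | h
          · rcases (pf y x).1 h with rfl | rfl
            · exact hyT
            · exact hf _ hyT
          · rcases (pg y x).1 h with rfl | rfl
            · exact hyT
            · exact hg _ hyT
    exact Set.eq_univ_of_forall fun x => hfin _ x rfl

end Braid

end Directions

/-! ### Point sets with as many slopes as points -/

section Slopes

variable {S : Type*} [Fintype S] {m : ℕ} {a b : S → ℝ} {t : ℕ → ℝ}

/-- The points with coordinates `a`, `b` are distinct and any two of them are joined by a line whose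
slope is one of the increasing numbers `t 0, …, t (m - 1)`. -/
structure SlopesIn (m : ℕ) (a b : S → ℝ) (t : ℕ → ℝ) : Prop where
  card : Fintype.card S = m
  mono : ∀ i j, i < j → j < m → t i < t j
  inj : ∀ p q, a p = a q → b p = b q → p = q
  slope : ∀ p q, p ≠ q → ∃ s < m, b p - t s * a p = b q - t s * a q

/-- The height of points in the direction of slope `t`. -/
def height (a b : S → ℝ) (t : ℝ) : S → ℝ := fun p => b p - t * a p

theorem SlopesIn.unique (h : SlopesIn m a b t) {i j : ℕ} (hi : i < m) (hj : j < m) {p q : S}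
    (hp : height a b (t i) p = height a b (t i) q) (hq : height a b (t j) p = height a b (t j) q)
    (hpq : p ≠ q) : i = j := by
  have ha : a p ≠ a q := fun ha => hpq (h.inj p q ha (by simpa [height, ha] using hp))
  by_contra hij
  have ht : t i ≠ t j := by
    rcases lt_or_gt_of_ne hij with h' | h'
    · exact (h.mono _ _ h' hj).ne
    · exact (h.mono _ _ h' hi).ne'
  have : (t i - t j) * (a p - a q) = 0 := by simp only [height] at hp hq; linarith
  rcases mul_eq_zero.1 this with h' | h'
  · exact ht (sub_eq_zero.1 h')
  · exact ha (sub_eq_zero.1 h')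

theorem SlopesIn.jointInj (h : SlopesIn m a b t) {i j : ℕ} (hi : i < m) (hj : j < m)
    (hij : i ≠ j) : JointInj (height a b (t i)) (height a b (t j)) := fun p q h1 h2 => by
  by_contra hpq
  exact hij (h.unique hi hj h1 h2 hpq)

theorem SlopesIn.mono_le (h : SlopesIn m a b t) {i j : ℕ} (hij : i ≤ j) (hj : j < m) :
    t i ≤ t j := by
  rcases hij.lt_or_eq with h' | rfl
  · exact (h.mono _ _ h' hj).le
  · exact le_rfl

/-- The order of two points by height reverses only when the direction passes the slope of their
line, and no such slope lies strictly between `t i` and `t (i + 1)`. -/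
theorem SlopesIn.comono (h : SlopesIn m a b t) {i : ℕ} (hi : i + 1 < m) :
    Comono (height a b (t i)) (height a b (t (i + 1))) := by
  intro p q hpq
  by_contra! hn
  obtain ⟨r, hr, hrpq⟩ := h.slope p q (by rintro rfl; exact lt_irrefl _ hpq)
  simp only [height] at hpq hn
  rcases Nat.lt_or_ge i r with h' | h'
  · have h1 : t (i + 1) ≤ t r := h.mono_le h' hr
    have h2 : t i < t r := h.mono _ _ h' hr
    have h3 : 0 < (t r - t i) * (a q - a p) := by linarith
    have h4 : (t r - t (i + 1)) * (a q - a p) < 0 := by linarith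
    have h5 : 0 < a q - a p := (pos_iff_pos_of_mul_pos h3).1 (by linarith)
    exact absurd h4 (not_lt.2 (mul_nonneg (by linarith) h5.le))
  · have h1 : t r ≤ t i := h.mono_le h' (by omega)
    have h2 : t r < t (i + 1) := h.mono _ _ (by omega) hi
    have h3 : 0 < (t i - t r) * (a p - a q) := by linarith
    have h4 : (t (i + 1) - t r) * (a p - a q) < 0 := by linarith
    have h5 : 0 < a p - a q := by
      by_contra! hle
      exact absurd h3 (not_lt.2 (mul_nonpos_of_nonneg_of_nonpos (by linarith) hle))
    exact absurd h4 (not_lt.2 (mul_nonneg (by linarith) h5.le))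

/-- Every slope lies between the first and the last, so a height difference changes sign at most
once on the way. The sign in the second height lets the last direction be followed cyclically by the
first. -/
theorem SlopesIn.comono_neg (h : SlopesIn (m + 1) a b t) :
    Comono (height a b (t m)) (fun p => - height a b (t 0) p) := by
  intro p q hpq
  obtain ⟨r, hr, hrpq⟩ := h.slope p q (by rintro rfl; exact lt_irrefl _ hpq)
  have h1 : t 0 ≤ t r := h.mono_le (Nat.zero_le _) hr
  have h2 : t r ≤ t m := h.mono_le (by omega) (by omega)
  simp only [height] at hpq ⊢
  have h3 : 0 < (t m - t r) * (a p - a q) := by linarith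
  have h4 : 0 ≤ a p - a q := by
    by_contra! hle
    exact absurd h3 (not_lt.2 (mul_nonpos_of_nonneg_of_nonpos (by linarith) hle.le))
  have h5 : 0 ≤ (t r - t 0) * (a p - a q) := mul_nonneg (by linarith) h4
  linarith

-- A one-point fibre is counted once as a fibre and once for its isolated point; any other fibre has
-- at least two points. Equality leaves no fibre with three.
open Classical in
theorem two_mul_card_image_le (f : S → ℝ) :
    2 * (Finset.univ.image f).card ≤
      Fintype.card S + (Finset.univ.filter fun p => ∀ q, f q = f p → q = p).card ∧
    (2 * (Finset.univ.image f).card =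
      Fintype.card S + (Finset.univ.filter fun p => ∀ q, f q = f p → q = p).card →
      ∀ p q z, f p = f q → f p = f z → p = q ∨ p = z ∨ q = z) := by
  set T := Finset.univ.image f
  set U := Finset.univ.filter fun p => ∀ q, f q = f p → q = p with hU
  have hm : ∀ p ∈ (Finset.univ : Finset S), f p ∈ T := fun p hp => Finset.mem_image_of_mem f hp
  have h1 := Finset.card_eq_sum_card_fiberwise (f := f) (s := Finset.univ) (t := T)
    (fun p hp => hm p hp)
  have h2 := Finset.card_eq_sum_card_fiberwise (f := f) (s := U) (t := T)
    (fun p _ => hm p (Finset.mem_univ _))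
  rw [Finset.card_univ] at h1
  have hterm : ∀ v ∈ T, 2 ≤ (Finset.univ.filter fun p => f p = v).card +
      (U.filter fun p => f p = v).card := by
    intro v hv
    obtain ⟨p, -, rfl⟩ := Finset.mem_image.1 hv
    have hp1 : p ∈ Finset.univ.filter fun q => f q = f p := by simp
    by_cases hp : p ∈ U
    · have h3 : 0 < (Finset.univ.filter fun q => f q = f p).card := Finset.card_pos.2 ⟨p, hp1⟩
      have h4 : 0 < (U.filter fun q => f q = f p).card :=
        Finset.card_pos.2 ⟨p, by simp [hp]⟩
      omega
    · have : ∃ q, f q = f p ∧ q ≠ p := by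
        simpa [hU] using hp
      obtain ⟨q, hq, hqp⟩ := this
      have : 1 < (Finset.univ.filter fun q => f q = f p).card :=
        Finset.one_lt_card.2 ⟨p, hp1, q, by simpa using hq, hqp.symm⟩
      omega
  have hsum : ∑ v ∈ T, 2 ≤ ∑ v ∈ T, ((Finset.univ.filter fun p => f p = v).card +
      (U.filter fun p => f p = v).card) := Finset.sum_le_sum hterm
  rw [Finset.sum_add_distrib, ← h1, ← h2, Finset.sum_const, smul_eq_mul, mul_comm] at hsum
  refine ⟨hsum, fun heq p q z hpq hpz => ?_⟩
  have heq' : ∑ v ∈ T, 2 = ∑ v ∈ T, ((Finset.univ.filter fun p => f p = v).card +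
      (U.filter fun p => f p = v).card) := by
    rw [Finset.sum_add_distrib, ← h1, ← h2, Finset.sum_const, smul_eq_mul, mul_comm]
    exact heq
  have hfib := (Finset.sum_eq_sum_iff_of_le hterm).1 heq' (f p) (hm p (Finset.mem_univ _))
  by_contra! hn
  have : 2 < (Finset.univ.filter fun q => f q = f p).card :=
    Finset.two_lt_card_iff.2 ⟨p, q, z, by simp, by simp [hpq], by simp [hpz], hn.1, hn.2.1, hn.2.2⟩
  omega

open Classical in
/-- The pairs of a direction and a point which is alone on its line in this direction. -/
noncomputable def simplePairs (m : ℕ) (a b : S → ℝ) (t : ℕ → ℝ) : Finset (ℕ × S) :=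
  (Finset.range m ×ˢ Finset.univ).filter fun sp =>
    ∀ q, height a b (t sp.1) q = height a b (t sp.1) sp.2 → q = sp.2

open Classical in
theorem card_simplePairs : (simplePairs m a b t).card = ∑ s ∈ Finset.range m,
    (Finset.univ.filter fun p => ∀ q, height a b (t s) q = height a b (t s) p → q = p).card := by
  simp only [simplePairs, Finset.card_filter, Finset.sum_product]

theorem sum_range_cyclic (n : ℕ) (c : ℕ → ℕ) :
    ∑ s ∈ Finset.range n, (c s + c (s + 1)) + (c n + c 0) = 2 * ∑ s ∈ Finset.range (n + 1), c s := by
  rw [Finset.sum_add_distrib, two_mul]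
  nth_rewrite 1 [Finset.sum_range_succ]
  rw [Finset.sum_range_succ']
  ring

open Classical in
/-- If there are only as many simple pairs as directions, no line contains three of the points and
the numbers of lines in two consecutive directions are as small as possible. -/
theorem SlopesIn.extremal (h : SlopesIn m a b t) (hm : 2 ≤ m)
    (hcard : (simplePairs m a b t).card = m) :
    (∀ s < m, ∀ p q z, height a b (t s) p = height a b (t s) q →
      height a b (t s) p = height a b (t s) z → p = q ∨ p = z ∨ q = z) ∧
    ∀ s, s + 1 < m → Tight (height a b (t s)) (height a b (t (s + 1))) := by
  obtain ⟨n, rfl⟩ : ∃ n, m = n + 1 := ⟨m - 1, by omega⟩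
  set c : ℕ → ℕ := fun s => (Finset.univ.image (height a b (t s))).card with hc
  have hne : Nonempty S := Fintype.card_pos_iff.1 (by rw [h.card]; omega)
  have hstep : ∀ s ∈ Finset.range n, n + 2 ≤ c s + c (s + 1) := by
    intro s hs
    rw [Finset.mem_range] at hs
    have := card_add_one_le_card_image_add (h.comono (i := s) (by omega))
      (h.jointInj (i := s) (j := s + 1) (by omega) (by omega) (by omega)) Finset.univ
      Finset.univ_nonempty
    rwa [Finset.card_univ, h.card] at this
  have hwrap : n + 2 ≤ c n + c 0 := by
    have := card_add_one_le_card_image_add h.comono_neg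
      (fun p q h1 h2 => h.jointInj (i := n) (j := 0) (by omega) (by omega) (by omega) p q h1
        (neg_injective h2)) Finset.univ Finset.univ_nonempty
    rw [Finset.card_univ, h.card] at this
    have himg : (Finset.univ.image fun p => - height a b (t 0) p) =
        (Finset.univ.image (height a b (t 0))).image Neg.neg := by
      rw [Finset.image_image]; rfl
    rw [himg, Finset.card_image_of_injective _ neg_injective] at this
    exact this
  have hcyc := sum_range_cyclic n c
  have hlow : ∑ s ∈ Finset.range n, (n + 2) ≤ ∑ s ∈ Finset.range n, (c s + c (s + 1)) :=
    Finset.sum_le_sum hstep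
  have hup : ∀ s ∈ Finset.range (n + 1), 2 * c s ≤ (n + 1) + (Finset.univ.filter fun p =>
      ∀ q, height a b (t s) q = height a b (t s) p → q = p).card := by
    intro s _
    have := (two_mul_card_image_le (height a b (t s))).1
    rwa [h.card] at this
  have hupsum := Finset.sum_le_sum hup
  have htot : ∑ s ∈ Finset.range (n + 1), ((n + 1) + (Finset.univ.filter fun p =>
      ∀ q, height a b (t s) q = height a b (t s) p → q = p).card) = (n + 1) * (n + 1) + (n + 1) := by
    rw [Finset.sum_add_distrib, ← card_simplePairs, hcard, Finset.sum_const, Finset.card_range,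
      smul_eq_mul]
  have hlow' : ∑ s ∈ Finset.range n, (n + 2) = n * (n + 2) := by simp
  rw [← Finset.mul_sum] at hupsum
  -- The lower and upper bounds for twice the number of lines coincide, so each summand is extremal.
  have harith : n * (n + 2) + (n + 2) = (n + 1) * (n + 1) + (n + 1) := by ring
  constructor
  · intro s hs
    have heq : ∑ s ∈ Finset.range (n + 1), 2 * c s = ∑ s ∈ Finset.range (n + 1),
        ((n + 1) + (Finset.univ.filter fun p =>
          ∀ q, height a b (t s) q = height a b (t s) p → q = p).card) := by
      rw [← Finset.mul_sum]; omega
    have := (Finset.sum_eq_sum_iff_of_le hup).1 heq s (Finset.mem_range.2 hs)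
    refine (two_mul_card_image_le (height a b (t s))).2 ?_
    rw [h.card]; exact this
  · intro s hs
    have heq : ∑ s ∈ Finset.range n, (n + 2) = ∑ s ∈ Finset.range n, (c s + c (s + 1)) := by omega
    have := (Finset.sum_eq_sum_iff_of_le hstep).1 heq s (Finset.mem_range.2 (by omega))
    refine tight_of_card_le (h.comono hs)
      (h.jointInj (i := s) (j := s + 1) (by omega) (by omega) (by omega)) ?_
    rw [h.card]; exact this.ge

open Classical in
/-- If no line contains three of the points, every point is alone on exactly one line. -/
theorem SlopesIn.card_simplePairs_eq (h : SlopesIn m a b t)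
    (h3 : ∀ s < m, ∀ p q z, height a b (t s) p = height a b (t s) q →
      height a b (t s) p = height a b (t s) z → p = q ∨ p = z ∨ q = z) :
    (simplePairs m a b t).card = m := by
  have hone : ∀ p, ((Finset.range m).filter fun s =>
      ∀ q, height a b (t s) q = height a b (t s) p → q = p).card = 1 := by
    intro p
    -- The `m - 1` other points lie in distinct directions from `p`, leaving exactly one of the `m`
    -- directions.
    choose d hd hdp using fun q : {q : S // q ≠ p} => h.slope q p q.2
    have hdinj : Function.Injective d := by
      intro q q' hqq
      have e1 : height a b (t (d q)) q = height a b (t (d q)) p := hdp q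
      have e2 : height a b (t (d q)) q' = height a b (t (d q)) p := by rw [hqq]; exact hdp q'
      rcases h3 (d q) (hd q) p q q' e1.symm e2.symm with h' | h' | h'
      · exact absurd h'.symm q.2
      · exact absurd h'.symm q'.2
      · exact Subtype.ext h'
    have hfil : ((Finset.range m).filter fun s =>
        ∀ q, height a b (t s) q = height a b (t s) p → q = p) =
        Finset.range m \ Finset.univ.image d := by
      ext s
      simp only [Finset.mem_filter, Finset.mem_range, Finset.mem_sdiff, Finset.mem_image,
        Finset.mem_univ, true_and, and_congr_right_iff]
      intro hs
      constructor
      · rintro hall ⟨q, rfl⟩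
        exact q.2 (hall q (hdp q))
      · intro hn q hq
        by_contra hqp
        exact hn ⟨⟨q, hqp⟩, h.unique (hd _) hs (hdp ⟨q, hqp⟩) hq hqp⟩
    have hsub : Finset.univ.image d ⊆ Finset.range m := by
      intro s hs
      obtain ⟨q, -, rfl⟩ := Finset.mem_image.1 hs
      exact Finset.mem_range.2 (hd q)
    rw [hfil, Finset.card_sdiff_of_subset hsub, Finset.card_range,
      Finset.card_image_of_injective _ hdinj, Finset.card_univ, Fintype.card_subtype_compl,
      Fintype.card_subtype_eq, h.card]
    have : 0 < m := h.card ▸ Fintype.card_pos_iff.2 ⟨p⟩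
    omega
  rw [simplePairs, Finset.card_filter, Finset.sum_product_right]
  simp only [← Finset.card_filter, hone]
  rw [Finset.sum_const, Finset.card_univ, h.card, smul_eq_mul, mul_one]

/-- In the extremal case, points and directions are labelled by `ℤ/m` such that two points have sum
of labels equal to the label of their direction. -/
theorem SlopesIn.exists_labels (h : SlopesIn m a b t) (hm : 2 ≤ m)
    (hcard : (simplePairs m a b t).card = m) :
    ∃ x : ZMod m → S, ∃ σ : ZMod m → ℕ, Function.Bijective x ∧ Function.Injective σ ∧
      (∀ s, σ s < m) ∧ ∀ i j s, i ≠ j →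
        (height a b (t (σ s)) (x i) = height a b (t (σ s)) (x j) ↔ s = i + j) := by
  classical
  obtain ⟨h3, htight⟩ := h.extremal hm hcard
  have hm0 : NeZero m := ⟨by omega⟩
  have hne : Nonempty S := Fintype.card_pos_iff.1 (by rw [h.card]; omega)
  choose! r hr using fun s (hs : s < m) => exists_isPartner (h3 s hs)
  have hjoint : ∀ s, s + 1 < m → JointInj (height a b (t s)) (height a b (t (s + 1))) :=
    fun s hs => h.jointInj (by omega) hs (by omega)
  have hbraid : ∀ s, s + 2 < m → ∀ p, r (s + 2) (r (s + 1) p) = r (s + 1) (r s p) := by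
    intro s hs p
    have l1 := h.mono s (s + 1) (by omega) (by omega)
    have l2 := h.mono (s + 1) (s + 2) (by omega) (by omega)
    -- The coefficients `c` and `d` express `t (s + 1)` as a convex combination of `t s` and `t (s +
    -- 2)`; height is affine in the slope.
    refine braid (h.comono (by omega)) (h.comono (i := s + 1) hs) (hjoint s (by omega))
      (hjoint (s + 1) hs) (htight s (by omega)) (htight (s + 1) hs) (hr s (by omega))
      (hr (s + 1) (by omega)) (hr (s + 2) hs)
      (c := (t (s + 2) - t (s + 1)) / (t (s + 2) - t s))
      (d := (t (s + 1) - t s) / (t (s + 2) - t s))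
      (div_pos (by linarith) (by linarith)) (div_pos (by linarith) (by linarith)) ?_ p
    intro p
    have : t (s + 2) - t s ≠ 0 := by linarith
    simp only [height]
    field_simp
    ring
  let R : ℕ → Equiv.Perm S := fun s =>
    if hs : s < m then (hr s hs).involutive.toPerm else 1
  have hR : ∀ s < m, ∀ p, R s p = r s p := by
    intro s hs p
    simp only [R, dif_pos hs]
    rfl
  have hRR : ∀ s < m, R s * R s = 1 := by
    intro s hs
    ext p
    rw [Equiv.Perm.mul_apply, hR s hs, hR s hs, (hr s hs).involutive p]
    rfl
  set ρ : Equiv.Perm S := R 1 * R 0 with hρ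
  have hstep : ∀ s, s + 1 < m → R (s + 1) * R s = ρ := by
    intro s
    induction s with
    | zero => intro _; rfl
    | succ s ih =>
      intro hs
      rw [← ih (by omega)]
      ext p
      rw [Equiv.Perm.mul_apply, Equiv.Perm.mul_apply, hR _ hs, hR _ (by omega), hR _ (by omega),
        hR _ (by omega), hbraid s hs p]
  have hRs : ∀ s < m, R s = ρ ^ (s : ℤ) * R 0 := by
    intro s
    induction s with
    | zero => intro _; simp
    | succ s ih =>
      intro hs
      have e1 : R (s + 1) = ρ * R s := by
        rw [← hstep s hs, mul_assoc, hRR s (by omega), mul_one]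
      rw [e1, ih (by omega), ← mul_assoc, Nat.cast_succ, add_comm, zpow_add, zpow_one]
  have h0inv : (R 0)⁻¹ = R 0 := inv_eq_of_mul_eq_one_left (hRR 0 (by omega))
  have h1inv : (R 1)⁻¹ = R 1 := inv_eq_of_mul_eq_one_left (hRR 1 (by omega))
  have hconj : ∀ i : ℤ, R 0 * ρ ^ i = ρ ^ (-i) * R 0 := by
    intro i
    have : R 0 * ρ * (R 0)⁻¹ = ρ⁻¹ := by
      rw [hρ, mul_inv_rev, h0inv, h1inv, mul_assoc, mul_assoc, hRR 0 (by omega), mul_one]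
    rw [zpow_neg, ← inv_zpow, ← this, conj_zpow, mul_assoc, inv_mul_cancel, mul_one]
  obtain ⟨q, hq, hgen⟩ := exists_fixed_generating (h.comono (i := 0) (by omega))
    (hjoint 0 (by omega)) (htight 0 (by omega)) (hr 0 (by omega)) (hr 1 (by omega))
  -- The offset `c` is `0` or `-1`, according to which of the two reflections fixes `q`.
  obtain ⟨c, hc⟩ : ∃ c : ℤ, R 0 q = (ρ ^ c) q := by
    rcases hq with hq | hq
    · exact ⟨0, by rw [hR 0 (by omega), hq]; rfl⟩
    · refine ⟨-1, ?_⟩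
      rw [zpow_neg_one, hρ, mul_inv_rev, h1inv, h0inv, Equiv.Perm.mul_apply, hR 1 (by omega), hq]
  have hR0 : ∀ i : ℤ, R 0 ((ρ ^ i) q) = (ρ ^ (c - i)) q := by
    intro i
    rw [← Equiv.Perm.mul_apply, hconj, Equiv.Perm.mul_apply, hc, ← Equiv.Perm.mul_apply,
      ← zpow_add, neg_add_eq_sub]
  have hRi : ∀ s < m, ∀ i : ℤ, R s ((ρ ^ i) q) = (ρ ^ (s + c - i)) q := by
    intro s hs i
    rw [hRs s hs, Equiv.Perm.mul_apply, hR0, ← Equiv.Perm.mul_apply, ← zpow_add, add_sub_assoc]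
  have hT : {p | ∃ i : ℤ, p = (ρ ^ i) q} = Set.univ := by
    apply hgen
    · exact ⟨0, by simp⟩
    · rintro _ ⟨i, rfl⟩
      exact ⟨c - i, by rw [← hR 0 (by omega), hR0]⟩
    · rintro _ ⟨i, rfl⟩
      exact ⟨1 + c - i, by rw [← hR 1 (by omega), hRi 1 (by omega)]; simp⟩
  have hcyc : ρ.IsCycleOn (Finset.univ : Finset S) := by
    refine ⟨by simp, fun p _ p' _ => ?_⟩
    obtain ⟨i, rfl⟩ : p ∈ {p | ∃ i : ℤ, p = (ρ ^ i) q} := hT ▸ Set.mem_univ _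
    obtain ⟨j, rfl⟩ : p' ∈ {p | ∃ i : ℤ, p = (ρ ^ i) q} := hT ▸ Set.mem_univ _
    exact ⟨j - i, by rw [← Equiv.Perm.mul_apply, ← zpow_add, sub_add_cancel]⟩
  have hzpow : ∀ i j : ℤ, (ρ ^ i) q = (ρ ^ j) q ↔ (i : ZMod m) = j := by
    intro i j
    rw [hcyc.zpow_apply_eq_zpow_apply (Finset.mem_univ q), Finset.card_univ, h.card,
      ZMod.intCast_eq_intCast_iff]
  have hcast : ∀ i : ZMod m, ((i.val : ℤ) : ZMod m) = i := fun i => by simp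
  -- The reflection `R s` sends point `i` to point `s + c - i`; shifting directions by `c` turns
  -- this into sum of labels equals label of direction.
  refine ⟨fun i => (ρ ^ (i.val : ℤ)) q, fun s => (s - (c : ZMod m)).val, ⟨fun i j hij => ?_,
    fun p => ?_⟩, fun s s' hss => ?_, fun s => ZMod.val_lt _, fun i j s hij => ?_⟩
  · rw [hzpow, hcast, hcast] at hij
    exact hij
  · obtain ⟨i, rfl⟩ : p ∈ {p | ∃ i : ℤ, p = (ρ ^ i) q} := hT ▸ Set.mem_univ _
    exact ⟨(i : ZMod m), (hzpow _ _).2 (hcast _)⟩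
  · exact sub_left_injective (ZMod.val_injective m hss)
  · rw [hr _ (ZMod.val_lt _), ← hR _ (ZMod.val_lt _), hRi _ (ZMod.val_lt _), hzpow, hzpow, hcast,
      hcast, or_iff_right hij.symm]
    push_cast
    rw [ZMod.natCast_zmod_val, ZMod.natCast_zmod_val, sub_add_cancel, eq_sub_iff_add_eq, add_comm,
      eq_comm]

end Slopes

open Projectivization

/-! ### Incidence, modular points and dual affine coordinates -/

section Geometry

/-- The points, and also the lines, of the real projective plane. -/
abbrev Plane : Type := Projectivization ℝ (Fin 3 → ℝ)

theorem orthogonal_iff_rep {P l : Plane} : orthogonal P l ↔ P.rep ⬝ᵥ l.rep = 0 := by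
  conv_lhs => rw [← P.mk_rep, ← l.mk_rep]
  exact orthogonal_mk _ _

theorem conc_of_orthogonal {P a b c : Plane} (ha : orthogonal P a) (hb : orthogonal P b)
    (hc : orthogonal P c) : Conc a b c := by
  rw [orthogonal_iff_rep, dotProduct_comm] at ha hb hc
  rw [conc_iff_det, ← Matrix.exists_mulVec_eq_zero_iff]
  refine ⟨P.rep, P.rep_nonzero, ?_⟩
  ext i
  fin_cases i <;> simpa [Matrix.mulVec]

theorem exists_orthogonal_of_conc {a b c : Plane} (h : Conc a b c) :
    ∃ P, orthogonal P a ∧ orthogonal P b ∧ orthogonal P c := by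
  rw [conc_iff_det, ← Matrix.exists_mulVec_eq_zero_iff] at h
  obtain ⟨v, hv, h⟩ := h
  have key : ∀ i : Fin 3, v ⬝ᵥ (![a.rep, b.rep, c.rep] i) = 0 := fun i => by
    rw [dotProduct_comm]
    exact congrFun h i
  refine ⟨mk ℝ v hv, ?_, ?_, ?_⟩
  · rw [← a.mk_rep, orthogonal_mk]; exact key 0
  · rw [← b.mk_rep, orthogonal_mk]; exact key 1
  · rw [← c.mk_rep, orthogonal_mk]; exact key 2

theorem eq_cross {P a b : Plane} (hab : a ≠ b) (ha : orthogonal P a) (hb : orthogonal P b) :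
    P = cross a b := by
  induction P using Projectivization.ind with | h p hp =>
  induction a using Projectivization.ind with | h a ha0 =>
  induction b using Projectivization.ind with | h b hb0 =>
  rw [orthogonal_mk] at ha hb
  rw [cross_mk_of_ne _ _ hab, mk_eq_mk_iff_crossProduct_eq_zero, cross_cross_eq_smul_sub_smul', hb,
    dotProduct_comm a p, ha]
  simp

theorem eq_of_orthogonal {P Q a b : Plane} (hab : a ≠ b) (ha : orthogonal P a)
    (hb : orthogonal P b) (ha' : orthogonal Q a) (hb' : orthogonal Q b) : P = Q :=
  (eq_cross hab ha hb).trans (eq_cross hab ha' hb').symm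

theorem line_eq_of_orthogonal {P Q a b : Plane} (hPQ : P ≠ Q) (ha : orthogonal P a)
    (hb : orthogonal P b) (ha' : orthogonal Q a) (hb' : orthogonal Q b) : a = b := by
  rw [orthogonal_comm] at ha hb ha' hb'
  exact eq_of_orthogonal hPQ ha ha' hb hb'

theorem orthogonal_of_conc {P a b c : Plane} (hab : a ≠ b) (ha : orthogonal P a)
    (hb : orthogonal P b) (h : Conc a b c) : orthogonal P c := by
  obtain ⟨Q, h1, h2, h3⟩ := exists_orthogonal_of_conc h
  rwa [eq_of_orthogonal hab ha hb h1 h2]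

open Classical in
/-- The lines of the arrangement through a point. -/
noncomputable def thru (A : Arrangement) (P : Plane) : Finset Plane := A.filter (orthogonal P)

theorem mem_thru {A : Arrangement} {P l : Plane} : l ∈ thru A P ↔ l ∈ A ∧ orthogonal P l := by
  simp [thru]

theorem mult_eq_card (A : Arrangement) (P : Plane) : mult A P = (thru A P).card := by
  rw [mult, ← Set.ncard_coe_finset]
  congr 1
  ext l
  simp [mem_thru]

/-- The point `P` is modular. -/
def Modular (A : Arrangement) (P : Plane) : Prop :=
  ∀ Q ∈ Sing A, Q ≠ P → ∃ l ∈ A, orthogonal P l ∧ orthogonal Q l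

theorem mem_sing {A : Arrangement} {P a b : Plane} (ha : a ∈ A) (hb : b ∈ A) (hab : a ≠ b)
    (hPa : orthogonal P a) (hPb : orthogonal P b) : P ∈ Sing A :=
  ⟨a, ha, b, hb, hab, hPa, hPb⟩

/-- A point whose multiplicity is at least that of a modular point is modular. -/
theorem Modular.of_mult_le {A : Arrangement} {P Q : Plane} (hP : Modular A P) (hQ : Q ∈ Sing A)
    (h : mult A P ≤ mult A Q) : Modular A Q := by
  classical
  by_cases hPQ : Q = P
  · rwa [hPQ]
  intro R hR hRQ
  by_contra! hn
  have hRP : R ≠ P := by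
    rintro rfl
    obtain ⟨l, hl, h1, h2⟩ := hP Q hQ hPQ
    exact hn l hl h2 h1
  obtain ⟨g, hg, hPg, hRg⟩ := hP R hR hRP
  -- Suppose no line of `A` joins `Q` and `R`. Cutting the lines through `Q` with `n` and joining
  -- the intersections to `P` injects them into the lines through `P`. The line `g` through `P` and
  -- `R` is missed, so `P` has larger multiplicity than `Q`.
  obtain ⟨n, hnA, hRn, hPn⟩ : ∃ n ∈ A, orthogonal R n ∧ ¬ orthogonal P n := by
    obtain ⟨a, ha, b, hb, hab, hRa, hRb⟩ := hR
    by_cases hPa : orthogonal P a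
    · exact ⟨b, hb, hRb, fun hPb => hab (line_eq_of_orthogonal hRP hRa hRb hPa hPb)⟩
    · exact ⟨a, ha, hRa, hPa⟩
  have hQn : ¬ orthogonal Q n := fun hQn => hn n hnA hQn hRn
  have hex : ∀ l ∈ thru A Q, ∃ k ∈ thru A P, ∃ Z, orthogonal Z l ∧ orthogonal Z n ∧
      orthogonal Z k := by
    intro l hl
    rw [mem_thru] at hl
    have hln : l ≠ n := by rintro rfl; exact hQn hl.2
    have hZ := mem_sing hl.1 hnA hln (cross_orthogonal_left hln) (cross_orthogonal_right hln)
    obtain ⟨k, hk, hPk, hZk⟩ := hP _ hZ (by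
      intro h; exact hPn (h ▸ cross_orthogonal_right hln))
    exact ⟨k, mem_thru.2 ⟨hk, hPk⟩, _, cross_orthogonal_left hln, cross_orthogonal_right hln, hZk⟩
  choose! k hk Z hZl hZn hZk using hex
  have hinj : Set.InjOn k (thru A Q) := by
    intro l hl l' hl' hkk
    have hkn : k l ≠ n := fun h => hPn (h ▸ (mem_thru.1 (hk l hl)).2)
    have hZZ : Z l = Z l' := eq_of_orthogonal hkn (hZk l hl) (hZn l hl)
      (hkk ▸ hZk l' hl') (hZn l' hl')
    have hZQ : Z l ≠ Q := fun h => hQn (h ▸ hZn l hl)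
    exact line_eq_of_orthogonal hZQ (hZl l hl) (hZZ ▸ hZl l' hl') (mem_thru.1 hl).2
      (mem_thru.1 hl').2
  have hgn : g ≠ n := by rintro rfl; exact hPn hPg
  have hgk : g ∉ (thru A Q).image k := by
    intro h
    obtain ⟨l, hl, rfl⟩ := Finset.mem_image.1 h
    have : Z l = R := eq_of_orthogonal hgn (hZk l hl) (hZn l hl) hRg hRn
    exact hn l (mem_thru.1 hl).1 (mem_thru.1 hl).2 (this ▸ hZl l hl)
  have hsub : insert g ((thru A Q).image k) ⊆ thru A P := by
    intro x hx
    rcases Finset.mem_insert.1 hx with rfl | hx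
    · exact mem_thru.2 ⟨hg, hPg⟩
    · obtain ⟨l, hl, rfl⟩ := Finset.mem_image.1 hx
      exact hk l hl
  have := Finset.card_le_card hsub
  rw [Finset.card_insert_of_notMem hgk, Finset.card_image_of_injOn hinj] at this
  rw [mult_eq_card, mult_eq_card] at h
  omega

/-- The lines of the arrangement that avoid a point. -/
abbrev Off (A : Arrangement) (P : Plane) : Type := {l : Plane // l ∈ A ∧ ¬ orthogonal P l}

open scoped Matrix in
/-- Affine coordinates in the dual plane such that the line dual to `P` is at infinity and none of
the lines of the arrangement through `P` is the vertical direction. -/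
theorem exists_coordinates (A : Arrangement) (P : Plane) (hP : (thru A P).Nonempty) :
    ∃ (t a b : Plane → ℝ), (∀ L ∈ thru A P, ∀ L' ∈ thru A P, t L = t L' → L = L') ∧
      (∀ l l', ¬ orthogonal P l → ¬ orthogonal P l' → a l = a l' → b l = b l' → l = l') ∧
      ∀ L ∈ thru A P, ∀ l l', ¬ orthogonal P l → ¬ orthogonal P l' →
        (Conc L l l' ↔ height a b (t L) l = height a b (t L) l') := by
  -- A functional nonzero on the finitely many lines through `P` serves as the denominator of their
  -- slopes, which keeps them all finite.
  obtain ⟨φ, hφ⟩ := Module.exists_dual_forall_apply_ne_zero (K := ℝ)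
    (fun L : thru A P => (L : Plane).rep) (fun L => rep_nonzero _)
  set p := P.rep with hp
  obtain ⟨w, hw⟩ : ∃ w : Fin 3 → ℝ, ∀ v, w ⬝ᵥ v = φ v := by
    refine ⟨fun i => φ (Pi.single i 1), fun v => ?_⟩
    conv_rhs => rw [pi_eq_sum_univ' v]
    simp [dotProduct, mul_comm, map_sum]
  set n := crossProduct w p with hn
  have hwL : ∀ L ∈ thru A P, w ⬝ᵥ L.rep ≠ 0 := fun L hL => by rw [hw]; exact hφ ⟨L, hL⟩
  have hpL : ∀ L, orthogonal P L ↔ p ⬝ᵥ L.rep = 0 := fun L => orthogonal_iff_rep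
  set G : Matrix (Fin 3) (Fin 3) ℝ := Matrix.of ![w, n, p] with hG
  have hn0 : n ≠ 0 := by
    intro h0
    obtain ⟨L, hL⟩ := hP
    have h1 : mk ℝ p P.rep_nonzero = mk ℝ w (by
        rintro rfl; exact hwL L hL (by simp)) := by
      rw [mk_eq_mk_iff_crossProduct_eq_zero, ← cross_anticomm, ← hn, h0, neg_zero]
    obtain ⟨c, hc⟩ := (mk_eq_mk_iff' _ _ _ _ _).1 h1.symm
    apply hwL L hL
    rw [← hc, smul_dotProduct, (hpL L).1 (mem_thru.1 hL).2, smul_zero]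
  have hdet : G.det ≠ 0 := by
    have : G.det = - (n ⬝ᵥ n) := by
      rw [hG, Matrix.det_fin_three, hn, cross_apply]
      simp [dotProduct, Fin.sum_univ_three]
      ring
    rw [this, neg_ne_zero]
    exact fun h => hn0 (dotProduct_self_eq_zero.1 h)
  have hrow : ∀ v, G *ᵥ v = ![w ⬝ᵥ v, n ⬝ᵥ v, p ⬝ᵥ v] := by
    intro v
    ext i
    fin_cases i <;> rfl
  have hGinj : Function.Injective G.mulVec :=
    Matrix.mulVec_injective_iff_isUnit.2 ((Matrix.isUnit_iff_isUnit_det _).2 hdet.isUnit)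
  have hprop : ∀ (l l' : Plane) (c : ℝ), c • (G *ᵥ l'.rep) = G *ᵥ l.rep → l = l' := by
    intro l l' c hc
    rw [← Matrix.mulVec_smul] at hc
    rw [← l.mk_rep, ← l'.mk_rep]
    exact (mk_eq_mk_iff' _ _ _ _ _).2 ⟨c, hGinj hc⟩
  refine ⟨fun L => (n ⬝ᵥ L.rep) / (w ⬝ᵥ L.rep), fun l => (w ⬝ᵥ l.rep) / (p ⬝ᵥ l.rep),
    fun l => (n ⬝ᵥ l.rep) / (p ⬝ᵥ l.rep), ?_, ?_, ?_⟩
  · intro L hL L' hL' h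
    have h1 := hwL L hL
    have h2 := hwL L' hL'
    have h3 := (hpL L).1 (mem_thru.1 hL).2
    have h4 := (hpL L').1 (mem_thru.1 hL').2
    refine hprop L L' ((w ⬝ᵥ L.rep) / (w ⬝ᵥ L'.rep)) ?_
    rw [hrow, hrow, h3, h4]
    ext i
    fin_cases i
    · simp [h2]
    · simp only [Fin.mk_one, Matrix.smul_cons, smul_eq_mul, Matrix.cons_val]
      field_simp at h ⊢
      linarith
    · simp
  · intro l l' hl hl' h h'
    rw [hpL] at hl hl'
    refine hprop l l' ((p ⬝ᵥ l.rep) / (p ⬝ᵥ l'.rep)) ?_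
    rw [hrow, hrow]
    ext i
    fin_cases i
    · simp only [Fin.zero_eta, Matrix.smul_cons, smul_eq_mul, Matrix.cons_val]
      field_simp at h ⊢
      linarith
    · simp only [Fin.mk_one, Matrix.smul_cons, smul_eq_mul, Matrix.cons_val]
      field_simp at h' ⊢
      linarith
    · simp [hl']
  · intro L hL l l' hl hl'
    have h1 := hwL L hL
    have h3 := (hpL L).1 (mem_thru.1 hL).2
    rw [hpL] at hl hl'
    -- In the coordinates given by `w`, `n`, `p`, with last coordinate `0` for `L`, the determinant
    -- becomes the comparison of heights after clearing denominators.
    have hmul : (Matrix.of ![L.rep, l.rep, l'.rep]).det * G.det =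
        (w ⬝ᵥ L.rep) * ((n ⬝ᵥ l.rep) * (p ⬝ᵥ l'.rep) - (p ⬝ᵥ l.rep) * (n ⬝ᵥ l'.rep)) -
        (n ⬝ᵥ L.rep) * ((w ⬝ᵥ l.rep) * (p ⬝ᵥ l'.rep) - (p ⬝ᵥ l.rep) * (w ⬝ᵥ l'.rep)) := by
      have h5 : Matrix.of ![L.rep, l.rep, l'.rep] * Gᵀ =
          Matrix.of ![G *ᵥ L.rep, G *ᵥ l.rep, G *ᵥ l'.rep] := by
        ext i j
        rw [Matrix.mul_apply]
        fin_cases i <;> simp [Matrix.mulVec, dotProduct, mul_comm]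
      rw [← Matrix.det_transpose G, ← Matrix.det_mul, h5, hrow, hrow, hrow, h3,
        Matrix.det_fin_three]
      simp
      ring
    have h6 : Conc L l l' ↔ (Matrix.of ![L.rep, l.rep, l'.rep]).det * G.det = 0 := by
      rw [conc_iff_det, mul_eq_zero, or_iff_left hdet]
    rw [h6, hmul]
    simp only [height]
    generalize w ⬝ᵥ L.rep = x at *
    generalize n ⬝ᵥ L.rep = y at *
    generalize p ⬝ᵥ l.rep = c at *
    generalize p ⬝ᵥ l'.rep = c' at *
    constructor
    · intro h
      field_simp
      linarith
    · intro h
      field_simp at h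
      linarith

end Geometry

/-! ### A modular pencil as a point set with prescribed slopes -/

section Pencil

noncomputable instance (A : Arrangement) (P : Plane) : Fintype (Off A P) :=
  (A.finite_toSet.subset fun _ hl => hl.1).fintype

/-- A modular point `P` of multiplicity `m`, in coordinates: the lines through `P` are
`d 0, …, d (m - 1)`, and the other lines are points in the plane, two of which meet on `d s` when
they have the same height in the direction of slope `t s`. -/
structure ModularPencil (A : Arrangement) (P : Plane) (m : ℕ) where
  d : ℕ → Plane
  t : ℕ → ℝ
  a : Off A P → ℝ
  b : Off A P → ℝ
  modular : Modular A P
  mem : ∀ s < m, d s ∈ thru A P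
  surj : ∀ L ∈ thru A P, ∃ s < m, d s = L
  mono : ∀ i j, i < j → j < m → t i < t j
  inj : ∀ p q, a p = a q → b p = b q → p = q
  conc : ∀ s < m, ∀ p q : Off A P, Conc (d s) p q ↔ height a b (t s) p = height a b (t s) q
  d_inj : ∀ i < m, ∀ j < m, d i = d j → i = j
  card_thru : (thru A P).card = m

theorem exists_modularPencil {A : Arrangement} {P : Plane} (hP : Modular A P) {m : ℕ} (hm : 0 < m)
    (hcard : (thru A P).card = m) : Nonempty (ModularPencil A P m) := by
  classical
  obtain ⟨t, a, b, ht, hinj, hconc⟩ :=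
    exists_coordinates A P (Finset.card_pos.1 (hcard ▸ hm))
  have hTcard : ((thru A P).image t).card = m := by
    rw [Finset.card_image_of_injOn, hcard]
    exact fun L hL L' hL' h => ht L hL L' hL' h
  let e := ((thru A P).image t).orderEmbOfFin hTcard
  have hex : ∀ i : Fin m, ∃ L ∈ thru A P, t L = e i := fun i =>
    Finset.mem_image.1 (Finset.orderEmbOfFin_mem _ hTcard i)
  choose d hd htd using hex
  have hdinj : Function.Injective d := fun i j hij => e.injective (by
    rw [← htd, ← htd, hij])
  -- The pencil is listed by increasing slope; the values `P` and `0` beyond `m` are never used.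
  refine ⟨⟨fun s => if h : s < m then d ⟨s, h⟩ else P, fun s => if h : s < m then e ⟨s, h⟩ else 0,
    fun l => a l, fun l => b l, hP, fun s hs => ?_, fun L hL => ?_, fun i j hij hj => ?_,
    fun p q h h' => ?_, fun s hs p q => ?_, fun i hi j hj hij => ?_, hcard⟩⟩
  · rw [dif_pos hs]; exact hd _
  · have : t L ∈ Set.range e := by
      rw [Finset.range_orderEmbOfFin]
      exact Finset.mem_image_of_mem t hL
    obtain ⟨i, hi⟩ := this
    refine ⟨i, i.2, ?_⟩
    rw [dif_pos i.2]
    exact ht _ (hd i) _ hL ((htd i).trans hi)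
  · rw [dif_pos (hij.trans hj), dif_pos hj]
    exact e.strictMono hij
  · exact Subtype.ext (hinj p q p.2.2 q.2.2 h h')
  · simp only [dif_pos hs]
    rw [hconc _ (hd _) p q p.2.2 q.2.2, htd]
    rfl
  · simp only [dif_pos hi, dif_pos hj] at hij
    simpa using hdinj hij

namespace ModularPencil

variable {A : Arrangement} {P : Plane} {m : ℕ} (M : ModularPencil A P m)

theorem orthogonal_d {s : ℕ} (hs : s < m) : orthogonal P (M.d s) := (mem_thru.1 (M.mem s hs)).2

theorem d_mem {s : ℕ} (hs : s < m) : M.d s ∈ A := (mem_thru.1 (M.mem s hs)).1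

theorem d_ne {s : ℕ} (hs : s < m) (p : Off A P) : M.d s ≠ p := fun h =>
  p.2.2 (h ▸ M.orthogonal_d hs)

theorem exists_d {Q : Plane} (hQ : Q ∈ Sing A) (hQP : Q ≠ P) : ∃ s < m, orthogonal Q (M.d s) := by
  obtain ⟨L, hL, hPL, hQL⟩ := M.modular Q hQ hQP
  obtain ⟨s, hs, rfl⟩ := M.surj L (mem_thru.2 ⟨hL, hPL⟩)
  exact ⟨s, hs, hQL⟩

theorem exists_height_eq {p q : Off A P} (hpq : p ≠ q) {Q : Plane} (hp : orthogonal Q p)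
    (hq : orthogonal Q q) :
    ∃ s < m, orthogonal Q (M.d s) ∧ height M.a M.b (M.t s) p = height M.a M.b (M.t s) q := by
  have hne : (p : Plane) ≠ q := fun h => hpq (Subtype.ext h)
  obtain ⟨s, hs, hQs⟩ := M.exists_d (mem_sing p.2.1 q.2.1 hne hp hq)
    (by rintro rfl; exact p.2.2 hp)
  exact ⟨s, hs, hQs, (M.conc s hs p q).1 (conc_of_orthogonal hQs hp hq)⟩

open Classical in
theorem slopesIn (hA : A.card = 2 * m) : SlopesIn m M.a M.b M.t where
  card := by
    have : Fintype.card (Off A P) = (A.filter fun l => ¬ orthogonal P l).card := by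
      exact Fintype.card_of_subtype _ fun l => by simp
    rw [this]
    have h1 := Finset.card_filter_add_card_filter_not (s := A) (orthogonal P)
    have h2 : (A.filter (orthogonal P)).card = m := M.card_thru
    omega
  mono := M.mono
  inj := M.inj
  slope := fun p q hpq => by
    have hne : (p : Plane) ≠ q := fun h => hpq (Subtype.ext h)
    obtain ⟨s, hs, -, h⟩ := M.exists_height_eq hpq (cross_orthogonal_left hne)
      (cross_orthogonal_right hne)
    exact ⟨s, hs, h⟩

-- Every singular point other than `P` lies on exactly one line of the pencil, and it is simple when
-- only one further line passes through it. The condition on `m` keeps `P` itself from being simple.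
open Classical in
theorem ncard_sing₂ (hm : m ≠ 2) :
    (Sing₂ A).ncard = (simplePairs m M.a M.b M.t).card := by
  have himage : Sing₂ A = (fun sp : ℕ × Off A P => cross (M.d sp.1) sp.2) ''
      (simplePairs m M.a M.b M.t : Set (ℕ × Off A P)) := by
    ext Q
    simp only [Set.mem_image, Finset.mem_coe, simplePairs, Finset.mem_filter, Finset.mem_product,
      Finset.mem_range, Finset.mem_univ, and_true, Prod.exists]
    constructor
    · rintro ⟨hQ, hmult⟩
      have hQP : Q ≠ P := by
        rintro rfl
        rw [mult_eq_card, M.card_thru] at hmult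
        exact hm hmult
      obtain ⟨s, hs, hQs⟩ := M.exists_d hQ hQP
      rw [mult_eq_card] at hmult
      obtain ⟨l, hl, hls⟩ : ∃ l ∈ thru A Q, l ≠ M.d s :=
        Finset.exists_mem_ne (by omega) _
      rw [mem_thru] at hl
      have hPl : ¬ orthogonal P l := fun hPl =>
        hls (line_eq_of_orthogonal hQP hl.2 hQs hPl (M.orthogonal_d hs))
      refine ⟨s, ⟨l, hl.1, hPl⟩, ⟨hs, fun q hq => ?_⟩, (eq_cross hls.symm hQs hl.2).symm⟩
      have hQq : orthogonal Q q := orthogonal_of_conc hls.symm hQs hl.2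
        ((M.conc s hs ⟨l, hl.1, hPl⟩ q).2 hq.symm)
      by_contra hne
      have : 2 < (thru A Q).card := Finset.two_lt_card_iff.2 ⟨M.d s, l, q,
        mem_thru.2 ⟨M.d_mem hs, hQs⟩, mem_thru.2 hl, mem_thru.2 ⟨q.2.1, hQq⟩, hls.symm,
        M.d_ne hs q, fun h => hne (Subtype.ext h.symm)⟩
      omega
    · rintro ⟨s, p, ⟨hs, hsimple⟩, rfl⟩
      have hne := M.d_ne hs p
      have h1 := cross_orthogonal_left hne
      have h2 := cross_orthogonal_right hne
      refine ⟨mem_sing (M.d_mem hs) p.2.1 hne h1 h2, ?_⟩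
      have hthru : thru A (cross (M.d s) p) = {M.d s, (p : Plane)} := by
        ext l
        rw [mem_thru, Finset.mem_insert, Finset.mem_singleton]
        constructor
        · rintro ⟨hl, hQl⟩
          by_cases hPl : orthogonal P l
          · left
            exact line_eq_of_orthogonal (fun h : cross (M.d s) p = P => p.2.2 (by rwa [h] at h2)) hQl h1 hPl
              (M.orthogonal_d hs)
          · right
            have := hsimple ⟨l, hl, hPl⟩ ((M.conc s hs _ _).1 (conc_of_orthogonal h1 hQl h2))
            exact congrArg Subtype.val this
        · rintro (rfl | rfl)
          · exact ⟨M.d_mem hs, h1⟩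
          · exact ⟨p.2.1, h2⟩
      rw [mult_eq_card, hthru, Finset.card_pair hne]
  rw [himage, Set.InjOn.ncard_image, Set.ncard_coe_finset]
  rintro ⟨s, p⟩ hsp ⟨s', p'⟩ hsp' hQ
  simp only [Finset.mem_coe, simplePairs, Finset.mem_filter, Finset.mem_product,
    Finset.mem_range, Finset.mem_univ, and_true] at hsp hsp' hQ
  have hne := M.d_ne hsp.1 p
  have hne' := M.d_ne hsp'.1 p'
  have h1 := cross_orthogonal_left hne
  have h2 := cross_orthogonal_right hne
  have h1' := cross_orthogonal_left hne'
  have h2' := cross_orthogonal_right hne'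
  rw [← hQ] at h1' h2'
  have hs : s = s' := M.d_inj _ hsp.1 _ hsp'.1 (line_eq_of_orthogonal
    (fun h : cross (M.d s) p = P => p.2.2 (by rwa [h] at h2)) h1 h1' (M.orthogonal_d hsp.1)
    (M.orthogonal_d hsp'.1))
  have hp : p' = p := hsp.2 p' ((M.conc s hsp.1 _ _).1 (conc_of_orthogonal h1 h2' h2))
  rw [hs, hp]

/-- The lines off `P` become `x` and those through `P` become `y`. Three concurrent lines off `P`
would, by modularity, meet on a pencil line and give three dual points of equal height, which
extremality excludes. -/
theorem exists_labelling (M : ModularPencil A P m) (hA : A.card = 2 * m) (hm : 3 ≤ m)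
    (hsing : (Sing₂ A).ncard = m) : Nonempty (Labelling m A) := by
  classical
  have hm0 : NeZero m := ⟨by omega⟩
  have hS := M.slopesIn hA
  rw [M.ncard_sing₂ (by omega)] at hsing
  have hsing' : (simplePairs m M.a M.b M.t).card = m := by convert hsing
  obtain ⟨x, σ, hx, hσ, hσm, hxy⟩ := hS.exists_labels (by omega) hsing'
  obtain ⟨h3, -⟩ := hS.extremal (by omega) hsing'
  have hσsurj : ∀ s < m, ∃ i, σ i = s := by
    have hinj : Function.Injective (fun i => (⟨σ i, hσm i⟩ : Fin m)) := fun i j h =>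
      hσ (by simpa using h)
    have hbij := (Fintype.bijective_iff_injective_and_card _).2
      ⟨hinj, by rw [ZMod.card, Fintype.card_fin]⟩
    intro s hs
    obtain ⟨i, hi⟩ := hbij.2 ⟨s, hs⟩
    exact ⟨i, by simpa using hi⟩
  refine ⟨⟨fun i => ⟨x i, (x i).2.1⟩, fun s => ⟨M.d (σ s), M.d_mem (hσm s)⟩, ⟨?_, ?_⟩, ?_, ?_, ?_, ?_⟩⟩
  · rintro (i | i) (j | j) h <;> simp only [Sum.elim_inl, Sum.elim_inr, Subtype.mk.injEq] at h
    · rw [hx.1 (Subtype.ext h)]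
    · exact absurd h.symm (M.d_ne (hσm j) _)
    · exact absurd h (M.d_ne (hσm i) _)
    · rw [hσ (M.d_inj _ (hσm i) _ (hσm j) h)]
  · rintro ⟨l, hl⟩
    by_cases hPl : orthogonal P l
    · obtain ⟨s, hs, rfl⟩ := M.surj l (mem_thru.2 ⟨hl, hPl⟩)
      obtain ⟨i, rfl⟩ := hσsurj s hs
      exact ⟨.inr i, rfl⟩
    · obtain ⟨i, hi⟩ := hx.2 ⟨l, hl, hPl⟩
      exact ⟨.inl i, Subtype.ext (congrArg (fun z : Off A P => (z : Plane)) hi)⟩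
  · intro i j s hij
    rw [← hxy i j s hij, ← M.conc _ (hσm s)]
    exact ⟨fun h => (conc_of_perm (conc_of_perm h).1).1, fun h => (conc_of_perm h).1⟩
  · intro i j k hij hjk hik h
    obtain ⟨Q, h1, h2, h3'⟩ := exists_orthogonal_of_conc h
    obtain ⟨s, hs, hQs, e1⟩ := M.exists_height_eq (hx.1.ne hij) h1 h2
    have e2 := (M.conc s hs (x i) (x k)).1 (conc_of_orthogonal hQs h1 h3')
    rcases h3 s hs _ _ _ e1 e2 with h | h | h
    · exact hij (hx.1 h)
    · exact hik (hx.1 h)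
    · exact hjk (hx.1 h)
  · intro i s t hst h
    have hne : M.d (σ s) ≠ M.d (σ t) := fun h => hst (hσ (M.d_inj _ (hσm s) _ (hσm t) h))
    exact (x i).2.2 (orthogonal_of_conc hne (M.orthogonal_d (hσm s)) (M.orthogonal_d (hσm t))
      (conc_of_perm h).1)
  · intro r s t
    exact conc_of_orthogonal (M.orthogonal_d (hσm r)) (M.orthogonal_d (hσm s))
      (M.orthogonal_d (hσm t))

-- It suffices that no three dual points are collinear in an available direction. Three such points
-- and their pencil line form a second pencil of four lines, sharing only that line with the pencil
-- at `P`.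
open Classical in
theorem ncard_sing₂_eq_of_os_equiv {K : Type*} [CommRing K] [IsDomain K] [CharZero K]
    {B : Arrangement} (M : ModularPencil A P m) (hA : A.card = 2 * m) (hm : 3 ≤ m) (hmax : ∀ Q ∈ Sing A, mult A Q ≤ m)
    (l : Labelling m B) (φ : OS K A ≃ₐ[K] OS K B) : (Sing₂ A).ncard = m := by
  have hm0 : NeZero m := ⟨by omega⟩
  rw [M.ncard_sing₂ (by omega)]
  convert (M.slopesIn hA).card_simplePairs_eq ?_ using 1
  intro s hs p q z hpq hpz
  by_contra! hn
  have hne := M.d_ne hs p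
  set Q := cross (M.d s) p
  have h0 : orthogonal Q (M.d s) := cross_orthogonal_left hne
  have hp : orthogonal Q p := cross_orthogonal_right hne
  have hq : orthogonal Q q := orthogonal_of_conc hne h0 hp ((M.conc s hs p q).2 hpq)
  have hz : orthogonal Q z := orthogonal_of_conc hne h0 hp ((M.conc s hs p z).2 hpz)
  set L : A := ⟨M.d s, M.d_mem hs⟩ with hL
  let o : Off A P → A := fun p => ⟨p, p.2.1⟩
  have ho : Function.Injective o := fun p q h =>
    Subtype.ext (congrArg (fun z : A => (z : Plane)) h)
  have hoL : ∀ p, L ≠ o p := fun p h => M.d_ne hs p (congrArg Subtype.val h)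
  set X : Finset A := Finset.univ.filter fun l => orthogonal P l
  set Y : Finset A := {L, o p, o q, o z} with hY
  have hYQ : ∀ a ∈ Y, orthogonal Q a := by
    intro a ha
    simp only [hY, Finset.mem_insert, Finset.mem_singleton] at ha
    rcases ha with rfl | rfl | rfl | rfl
    exacts [h0, hp, hq, hz]
  have hX : X.card = m := by
    rw [← M.card_thru, ← Finset.card_map (Function.Embedding.subtype _)]
    congr 1
    ext l
    simp [X, mem_thru]
    tauto
  have hY4 : Y.card = 4 := by
    rw [hY, Finset.card_insert_of_notMem, Finset.card_insert_of_notMem,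
      Finset.card_insert_of_notMem, Finset.card_singleton]
    · simpa using ho.ne hn.2.2
    · simpa using ⟨ho.ne hn.1, ho.ne hn.2.1⟩
    · simpa using ⟨hoL p, hoL q, hoL z⟩
  -- Maximality of `m` gives `4 ≤ m`, so the pencil at `P` is also large enough for the resonance
  -- argument.
  have hYle : Y.card ≤ m := by
    refine le_trans ?_ (hmax Q (mem_sing (M.d_mem hs) p.2.1 hne h0 hp))
    rw [mult_eq_card, ← Finset.card_map (Function.Embedding.subtype _)]
    apply Finset.card_le_card
    intro a ha
    obtain ⟨a, ha', rfl⟩ := Finset.mem_map.1 ha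
    exact mem_thru.2 ⟨a.2, hYQ a ha'⟩
  refine not_os_equiv_labelling l φ X Y (fun a ha b hb c hc => ?_)
    (fun a ha b hb c hc => conc_of_orthogonal (hYQ a ha) (hYQ b hb) (hYQ c hc)) hX (by omega)
    hY4.ge ?_
  · simp only [X, Finset.mem_filter, Finset.mem_univ, true_and] at ha hb hc
    exact conc_of_orthogonal ha hb hc
  · have : Y ∩ X ⊆ {L} := by
      intro a ha
      rw [Finset.mem_inter] at ha
      obtain ⟨h1, h2⟩ := ha
      simp only [X, Finset.mem_filter, Finset.mem_univ, true_and] at h2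
      simp only [hY, Finset.mem_insert, Finset.mem_singleton] at h1 ⊢
      rcases h1 with rfl | rfl | rfl | rfl
      · rfl
      · exact absurd h2 p.2.2
      · exact absurd h2 q.2.2
      · exact absurd h2 z.2.2
    exact (Finset.card_le_card this).trans_eq (Finset.card_singleton _)

end ModularPencil

end Pencil

/-! ### The labelling of the Böröczky arrangement -/

section Boroczky

theorem conc_mk_iff {u v w : Fin 3 → ℝ} (hu : u ≠ 0) (hv : v ≠ 0) (hw : w ≠ 0) :
    Conc (mk ℝ u hu) (mk ℝ v hv) (mk ℝ w hw) ↔ (Matrix.of ![u, v, w]).det = 0 := by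
  rw [← Matrix.exists_mulVec_eq_zero_iff]
  constructor
  · intro h
    obtain ⟨P, h1, h2, h3⟩ := exists_orthogonal_of_conc h
    induction P using Projectivization.ind with | h p hp =>
    rw [orthogonal_mk, dotProduct_comm] at h1 h2 h3
    refine ⟨p, hp, ?_⟩
    ext i
    fin_cases i <;> simpa [Matrix.mulVec]
  · rintro ⟨p, hp, h⟩
    have key : ∀ i : Fin 3, p ⬝ᵥ (![u, v, w] i) = 0 := fun i => by
      rw [dotProduct_comm]
      exact congrFun h i
    exact conc_of_orthogonal (P := mk ℝ p hp) ((orthogonal_mk _ _).2 (key 0))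
      ((orthogonal_mk _ _).2 (key 1)) ((orthogonal_mk _ _).2 (key 2))

variable {m : ℕ}

/-- The line tangent to the unit circle, with index `i`. -/
noncomputable def circleLine (m : ℕ) (i : ZMod m) : Plane :=
  mk ℝ ![Real.cos (2 * Real.pi * i.val / m), Real.sin (2 * Real.pi * i.val / m), 1] (vec₁_ne_zero _)

/-- The line through the centre of the unit circle, with index `s`. -/
noncomputable def centralLine (m : ℕ) (s : ZMod m) : Plane :=
  mk ℝ ![-Real.sin (Real.pi * s.val / m), Real.cos (Real.pi * s.val / m), 0] (vec₂_ne_zero _)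

theorem sin_pi_mul_div_eq_zero [NeZero m] (n : ℤ) :
    Real.sin (Real.pi * n / m) = 0 ↔ (n : ZMod m) = 0 := by
  have hm : (m : ℝ) ≠ 0 := Nat.cast_ne_zero.2 (NeZero.ne m)
  rw [Real.sin_eq_zero_iff, ZMod.intCast_zmod_eq_zero_iff_dvd]
  constructor
  · rintro ⟨k, hk⟩
    refine ⟨k, ?_⟩
    have hpi := Real.pi_ne_zero
    field_simp at hk
    exact_mod_cast (show (n : ℝ) = m * k by linarith)
  · rintro ⟨k, rfl⟩
    refine ⟨k, ?_⟩
    push_cast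
    field_simp

theorem sin_val_sub [NeZero m] (i j : ZMod m) :
    Real.sin (Real.pi * i.val / m - Real.pi * j.val / m) = 0 ↔ i = j := by
  have := sin_pi_mul_div_eq_zero (m := m) ((i.val : ℤ) - j.val)
  push_cast at this
  rw [ZMod.natCast_zmod_val, ZMod.natCast_zmod_val, sub_eq_zero, mul_sub, sub_div] at this
  exact this

/-- With half-angles `A`, `B` for the tangents and angle `C` for the central line, the determinant
factors as `2 sin (A + B - C) sin (A - B)`. The second factor is nonzero, and the first vanishes
exactly when the labels add up modulo `m`. -/
theorem conc_circleLine_centralLine [NeZero m] (i j s : ZMod m) (hij : i ≠ j) :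
    Conc (circleLine m i) (circleLine m j) (centralLine m s) ↔ s = i + j := by
  rw [circleLine, circleLine, centralLine, conc_mk_iff]
  have h1 : ∀ A B C : ℝ, (Matrix.of ![![Real.cos (2 * A), Real.sin (2 * A), 1],
      ![Real.cos (2 * B), Real.sin (2 * B), 1], ![-Real.sin C, Real.cos C, 0]]).det =
      2 * Real.sin (A + B - C) * Real.sin (A - B) := by
    intro A B C
    have h2 := Real.cos_sub_cos (2 * B - C) (2 * A - C)
    have e1 : (2 * B - C + (2 * A - C)) / 2 = A + B - C := by ring
    have e2 : (2 * B - C - (2 * A - C)) / 2 = -(A - B) := by ring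
    rw [e1, e2, Real.sin_neg, Real.cos_sub, Real.cos_sub] at h2
    rw [Matrix.det_fin_three]
    simp
    linarith
  have e : ∀ i : ZMod m, 2 * Real.pi * i.val / m = 2 * (Real.pi * i.val / m) := fun i => by ring
  rw [e, e, h1, mul_eq_zero, or_iff_left ((sin_val_sub i j).not.2 hij), mul_eq_zero,
    or_iff_right two_ne_zero]
  have := sin_pi_mul_div_eq_zero (m := m) ((i.val : ℤ) + j.val - s.val)
  push_cast at this
  rw [ZMod.natCast_zmod_val, ZMod.natCast_zmod_val, ZMod.natCast_zmod_val, sub_eq_zero, mul_sub,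
    mul_add, sub_div, add_div] at this
  rw [this, eq_comm]

/-- Dually, three points of a circle are not collinear; the determinant is a product of sines of the
half-angle differences. -/
theorem not_conc_circleLine [NeZero m] (i j k : ZMod m) (hij : i ≠ j) (hjk : j ≠ k) (hik : i ≠ k) :
    ¬ Conc (circleLine m i) (circleLine m j) (circleLine m k) := by
  rw [circleLine, circleLine, circleLine, conc_mk_iff]
  have h1 : ∀ A B C : ℝ, (Matrix.of ![![Real.cos (2 * A), Real.sin (2 * A), 1],
      ![Real.cos (2 * B), Real.sin (2 * B), 1], ![Real.cos (2 * C), Real.sin (2 * C), 1]]).det =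
      - 4 * Real.sin (A - B) * Real.sin (B - C) * Real.sin (A - C) := by
    intro A B C
    have key : ∀ u v : ℝ, Real.sin (2 * u) + Real.sin (2 * v) - Real.sin (2 * (u + v)) =
        4 * Real.sin u * Real.sin v * Real.sin (u + v) := by
      intro u v
      rw [Real.sin_two_mul, Real.sin_two_mul, Real.sin_two_mul, Real.sin_add, Real.cos_add]
      linear_combination -2 * Real.sin u * Real.cos u * Real.sin_sq_add_cos_sq v -
        2 * Real.sin v * Real.cos v * Real.sin_sq_add_cos_sq u
    have h := key (A - B) (B - C)
    rw [sub_add_sub_cancel, mul_sub, mul_sub, mul_sub, Real.sin_sub, Real.sin_sub,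
      Real.sin_sub] at h
    rw [Matrix.det_fin_three]
    simp
    linarith
  have e : ∀ i : ZMod m, 2 * Real.pi * i.val / m = 2 * (Real.pi * i.val / m) := fun i => by ring
  rw [e, e, e, h1]
  have h2 := (sin_val_sub i j).not.2 hij
  have h3 := (sin_val_sub j k).not.2 hjk
  have h4 := (sin_val_sub i k).not.2 hik
  exact mul_ne_zero (mul_ne_zero (mul_ne_zero (by norm_num) h2) h3) h4

theorem not_conc_circleLine_centralLine [NeZero m] (i s t : ZMod m) (hst : s ≠ t) :
    ¬ Conc (circleLine m i) (centralLine m s) (centralLine m t) := by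
  rw [circleLine, centralLine, centralLine, conc_mk_iff, Matrix.det_fin_three]
  have h := (sin_val_sub t s).not.2 hst.symm
  rw [Real.sin_sub] at h
  intro h'
  apply h
  simp [-ZMod.natCast_val] at h'
  linarith

theorem conc_centralLine (r s t : ZMod m) :
    Conc (centralLine m r) (centralLine m s) (centralLine m t) := by
  rw [centralLine, centralLine, centralLine, conc_mk_iff, Matrix.det_fin_three]
  simp

theorem mem_boroczky [NeZero m] {l : Plane} :
    l ∈ boroczky m ↔ (∃ i, circleLine m i = l) ∨ ∃ s, centralLine m s = l := by
  classical
  rw [boroczky, Finset.mem_union, Finset.mem_image, Finset.mem_image]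
  refine or_congr ?_ ?_
  · constructor
    · rintro ⟨j, hj, rfl⟩
      refine ⟨(j : ZMod m), ?_⟩
      simp only [circleLine, ZMod.val_cast_of_lt (Finset.mem_range.1 hj)]
    · rintro ⟨i, rfl⟩
      exact ⟨i.val, Finset.mem_range.2 (ZMod.val_lt i), rfl⟩
  · constructor
    · rintro ⟨j, hj, rfl⟩
      refine ⟨(j : ZMod m), ?_⟩
      simp only [centralLine, ZMod.val_cast_of_lt (Finset.mem_range.1 hj)]
    · rintro ⟨i, rfl⟩
      exact ⟨i.val, Finset.mem_range.2 (ZMod.val_lt i), rfl⟩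

/-- The Böröczky arrangement with its natural labelling. -/
noncomputable def boroczkyLabelling (m : ℕ) (hm : 2 ≤ m) : Labelling m (boroczky m) :=
  haveI : NeZero m := ⟨by omega⟩
  haveI : Fact (1 < m) := ⟨hm⟩
  { x := fun i => ⟨circleLine m i, mem_boroczky.2 (Or.inl ⟨i, rfl⟩)⟩
    y := fun s => ⟨centralLine m s, mem_boroczky.2 (Or.inr ⟨s, rfl⟩)⟩
    bij := by
      -- Coinciding lines would be concurrent with every third line, so injectivity follows from the
      -- concurrency rules once a second label is available.
      have hne : ∀ s : ZMod m, s ≠ s + 1 := fun s h => one_ne_zero (left_eq_add.1 h)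
      have hxy : ∀ i s, circleLine m i ≠ centralLine m s := fun i s h =>
        not_conc_circleLine_centralLine i s (s + 1) (hne s) (h ▸ conc_self _ _)
      refine ⟨?_, ?_⟩
      · rintro (i | i) (j | j) h <;>
          simp only [Sum.elim_inl, Sum.elim_inr, Subtype.mk.injEq] at h
        · by_contra hij
          have hij' : i ≠ j := fun h => hij (h ▸ rfl)
          exact hne (i + j) ((conc_circleLine_centralLine i j _ hij').1
            (h ▸ conc_self _ _)).symm
        · exact absurd h (hxy _ _)
        · exact absurd h.symm (hxy _ _)
        · by_contra hij
          have hij' : i ≠ j := fun h => hij (h ▸ rfl)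
          refine not_conc_circleLine_centralLine 0 i j hij' ?_
          rw [h, conc_swap, conc_swap']
          exact conc_self _ _
      · rintro ⟨l, hl⟩
        rcases mem_boroczky.1 hl with ⟨i, rfl⟩ | ⟨s, rfl⟩
        · exact ⟨.inl i, rfl⟩
        · exact ⟨.inr s, rfl⟩
    xxy := conc_circleLine_centralLine
    xxx := not_conc_circleLine
    xyy := not_conc_circleLine_centralLine
    yyy := conc_centralLine }

end Boroczky

end LineArr

theorem theorem2p6 {K : Type*} [CommRing K] [IsDomain K] [CharZero K]
    (A : LineArr.Arrangement) (hA : LineArr.Supersolvable A)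
    (hm : 3 ≤ LineArr.maxMult A) (hcard : A.card = 2 * LineArr.maxMult A) :
    ((LineArr.Sing₂ A).ncard = LineArr.maxMult A ↔
      Nonempty (LineArr.OS K A ≃ₐ[K] LineArr.OS K (LineArr.boroczky (LineArr.maxMult A)))) ∧
    ((LineArr.Sing₂ A).ncard = LineArr.maxMult A ↔
      ∃ φ : LineArr.OS K A ≃ₐ[K] LineArr.OS K (LineArr.boroczky (LineArr.maxMult A)),
        ∀ k : ℕ, (LineArr.OSDeg K A k).map φ.toLinearMap =
          LineArr.OSDeg K (LineArr.boroczky (LineArr.maxMult A)) k) := by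
  obtain ⟨P, hP, hmod⟩ := hA
  obtain ⟨⟨Q, hQ, hQm⟩, hmax⟩ := LineArr.isGreatest_maxMult A ⟨P, hP⟩
  have hmult : ∀ R ∈ LineArr.Sing A, LineArr.mult A R ≤ LineArr.maxMult A := fun R hR =>
    hmax ⟨R, hR, rfl⟩
  -- The modular point given by supersolvability need not have maximal multiplicity; the count needs
  -- one that does.
  have hQmod : LineArr.Modular A Q :=
    LineArr.Modular.of_mult_le (P := P) hmod hQ (hQm ▸ hmult P hP)
  obtain ⟨M⟩ := LineArr.exists_modularPencil hQmod (by omega : 0 < LineArr.maxMult A)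
    (by rw [← LineArr.mult_eq_card, hQm])
  have lB := LineArr.boroczkyLabelling (LineArr.maxMult A) (by omega)
  have hgraded : (LineArr.Sing₂ A).ncard = LineArr.maxMult A →
      ∃ φ : LineArr.OS K A ≃ₐ[K] LineArr.OS K (LineArr.boroczky (LineArr.maxMult A)),
        ∀ k : ℕ, (LineArr.OSDeg K A k).map φ.toLinearMap =
          LineArr.OSDeg K (LineArr.boroczky (LineArr.maxMult A)) k := fun h => by
    obtain ⟨lA⟩ := M.exists_labelling hcard hm h
    exact lA.exists_graded_os_equiv lB
  have hback : ∀ _ : LineArr.OS K A ≃ₐ[K] LineArr.OS K (LineArr.boroczky (LineArr.maxMult A)),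
      (LineArr.Sing₂ A).ncard = LineArr.maxMult A := fun φ =>
    M.ncard_sing₂_eq_of_os_equiv hcard hm hmult lB φ
  exact ⟨⟨fun h => ⟨(hgraded h).choose⟩, fun ⟨φ⟩ => hback φ⟩,
    ⟨hgraded, fun ⟨φ, _⟩ => hback φ⟩⟩
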